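/- Let $d\ge 4$ and $b\ge 1$ be integers. For a finite simplicial complex $K$ whose largest faces have $d$ vertices, let $f_i(K)$ be the number of $i$-dimensional faces of $K$ and $g_2(K)=f_1(K)-d\,f_0(K)+\binom{d+1}{2}$. A missing face of $K$ is a set of vertices of $K$ that is not a face of $K$ but all of whose proper subsets are faces of $K$. A simplicial $d$-polytope $P$ is called prime if its boundary complex $\partial P$ has no missing face with exactly $d$ vertices and is not the boundary complex of a simplex. Then there exist prime $d$-polytopes $P$ with $g_2(\partial P)=b$ and with arbitrarily large $f_0(\partial P)$: for every $N\in\mathbb{N}$ there is a prime $d$-polytope $P$ with $g_2(\partial P)=b$ and $f_0(\partial P)\ge N$. Moreover, $P$ can be chosen so that, for some $n\ge 3$, it is obtained by $b-1$ successive stellar subdivisions at ridges (faces of dimension $d-2$), through simplicial $d$-polytopes and up to combinatorial isomorphism at each step, starting from a free sum of a convex polygon with $n$ vertices and a $(d-2)$-simplex. Here the free sum of two polytopes, placed in orthogonal linear subspaces with the origin in the relative interior of each, is the convex hull of their union. The stellar subdivision of a simplicial complex $K$ at a nonempty face $F$ is the complex obtained from $K$ by removing all faces that contain $F$ and adding,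 for a new vertex $w$, all sets $T\cup\{w\}$ with $F\not\subseteq T$ and $T\cup F\in K$ ($T$ may be empty). -/

import Mathlib

/-! ### Abstract simplicial complexes

The complexes are Mathlib's `PreAbstractSimplicialComplex`: families of nonempty finite sets that
are closed under passing to nonempty subsets (the empty face is left implicit). -/

namespace PreAbstractSimplicialComplex

variable {α β : Type*}

/-- The vertices of a complex. -/
def vertexSet (K : PreAbstractSimplicialComplex α) : Set α :=
  {v | {v} ∈ K.faces}

/-- `K.f i` is the number of `i`-dimensional faces of a finite complex, i.e. of faces with
`i + 1` elements. -/
noncomputable def f (K : PreAbstractSimplicialComplex α) (i : ℕ) : ℕ :=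
  {s ∈ K.faces | s.card = i + 1}.ncard

/-- The maximal size of a face of a finite complex (its dimension plus one). -/
noncomputable def maxFaceSize (K : PreAbstractSimplicialComplex α) : ℕ :=
  sSup (Finset.card '' K.faces)

/-- `g₂(K) = f₁(K) - d f₀(K) + (d+1 choose 2)`, where `d` is the maximal size of a face. -/
noncomputable def g2 (K : PreAbstractSimplicialComplex α) : ℤ :=
  (K.f 1 : ℤ) - (K.maxFaceSize : ℤ) * (K.f 0 : ℤ) + ((K.maxFaceSize + 1).choose 2 : ℤ)

/-- A missing face: a set of vertices which is not a face although all its proper (nonempty)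
subsets are. -/
def IsMissingFace (K : PreAbstractSimplicialComplex α) (F : Finset α) : Prop :=
  F.Nonempty ∧ (F : Set α) ⊆ K.vertexSet ∧ F ∉ K.faces ∧
    ∀ G : Finset α, G.Nonempty → G ⊂ F → G ∈ K.faces

/-- `K` is the boundary complex of a simplex: its faces are all the proper (nonempty) subsets of
a finite set. -/
def IsSimplexBoundary (K : PreAbstractSimplicialComplex α) : Prop :=
  ∃ V : Finset α, ∀ s : Finset α, s ∈ K.faces ↔ s.Nonempty ∧ s ⊂ V

open Classical in
/-- Combinatorial isomorphism: a map of vertices, injective on the vertices of `K`, under which the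
faces of `L` are exactly the images of the faces of `K`. -/
def IsIsomorphicTo (K : PreAbstractSimplicialComplex α) (L : PreAbstractSimplicialComplex β) :
    Prop :=
  ∃ φ : α → β, Set.InjOn φ K.vertexSet ∧ K.map φ = L

open Classical in
/-- The stellar subdivision of `K` at a face `F`. The new vertex is `none`. Every face containing
`F` is removed, and for every (possibly empty) `T` with `F ⊄ T` and `F ∪ T ∈ K`, the set `T`
together with the new vertex is added. In the definition, `s.eraseNone` is the set of old vertices
of `s`. -/
noncomputable def stellarSubdivision (K : PreAbstractSimplicialComplex α) (F : Finset α) :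
    PreAbstractSimplicialComplex (Option α) where
  faces := {s | s.Nonempty ∧ ¬ F ⊆ s.eraseNone ∧
    (none ∉ s → s.eraseNone ∈ K.faces) ∧ (none ∈ s → F ∪ s.eraseNone ∈ K.faces)}
  isRelLowerSet_faces := by
    rintro s ⟨hs, hF, h1, h2⟩
    refine ⟨hs, fun t hts ht => ?_⟩
    have hts' : t ⊆ s := hts
    have hsub : t.eraseNone ⊆ s.eraseNone := Finset.eraseNone.monotone hts'
    refine ⟨ht, fun h => hF (h.trans hsub), fun hnt => ?_, fun hnt => ?_⟩
    · have hne : t.eraseNone.Nonempty := by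
        obtain ⟨x, hx⟩ := ht
        cases x with
        | none => exact absurd hx hnt
        | some x => exact ⟨x, Finset.mem_eraseNone.2 hx⟩
      by_cases hns : none ∈ s
      · exact (K.isRelLowerSet_faces (h2 hns)).2
          (hsub.trans Finset.subset_union_right) hne
      · exact (K.isRelLowerSet_faces (h1 hns)).2 hsub hne
    · have hFne : F.Nonempty := by
        by_contra h
        rw [Finset.not_nonempty_iff_eq_empty] at h
        exact hF (by simp [h])
      exact (K.isRelLowerSet_faces (h2 (hts' hnt))).2
        (Finset.union_subset_union_right hsub) (hFne.mono Finset.subset_union_left)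

end PreAbstractSimplicialComplex

/-! ### Convex polytopes -/

section Polytopes

variable {E : Type*} [NormedAddCommGroup E]

/-- A `d`-polytope: the convex hull of a nonempty finite set, of affine dimension `d`. -/
def IsPolytopeOfDim [NormedSpace ℝ E] (d : ℕ) (P : Set E) : Prop :=
  (∃ V : Finset E, V.Nonempty ∧ P = convexHull ℝ (V : Set E)) ∧
    Module.finrank ℝ (vectorSpan ℝ P) = d

/-- A (possibly empty) simplex: the convex hull of a finite affinely independent set. -/
def IsConvexSimplex [NormedSpace ℝ E] (S : Set E) : Prop :=
  ∃ V : Finset E, AffineIndependent ℝ ((↑) : V → E) ∧ S = convexHull ℝ (V : Set E)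

/-- A proper face of `P`: an exposed subset (the set where some linear functional attains its
maximum on `P`, or the empty set) different from `P`. -/
def IsProperFace [NormedSpace ℝ E] (P F : Set E) : Prop :=
  IsExposed ℝ P F ∧ F ≠ P

/-- A simplicial `d`-polytope: all proper faces are simplices. -/
def IsSimplicialPolytope [NormedSpace ℝ E] (d : ℕ) (P : Set E) : Prop :=
  IsPolytopeOfDim d P ∧ ∀ F : Set E, IsProperFace P F → IsConvexSimplex F

/-- The boundary complex of a simplicial polytope: its faces are the nonempty sets of vertices of
proper faces. As every subset of the vertices of a simplex spans a face of this simplex, these are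
exactly the vertex sets of the nonempty proper faces. -/
def boundaryComplex [NormedSpace ℝ E] (P : Set E) : PreAbstractSimplicialComplex E where
  faces := {s | s.Nonempty ∧ ∃ F : Set E, IsProperFace P F ∧ (s : Set E) ⊆ F.extremePoints ℝ}
  isRelLowerSet_faces := by
    rintro s ⟨hs, F, hF, hsF⟩
    refine ⟨hs, fun t hts ht => ⟨ht, F, hF, ?_⟩⟩
    have hts' : t ⊆ s := hts
    exact (Finset.coe_subset.2 hts').trans hsF

/-- A prime `d`-polytope: a simplicial `d`-polytope whose boundary complex has no missing
`(d-1)`-face (a missing face with `d` elements) and is not the boundary complex of a simplex. -/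
def IsPrimePolytope [NormedSpace ℝ E] (d : ℕ) (P : Set E) : Prop :=
  IsSimplicialPolytope d P ∧
    (∀ F : Finset E, (boundaryComplex P).IsMissingFace F → F.card ≠ d) ∧
    ¬ (boundaryComplex P).IsSimplexBoundary

/-- `R` is a free sum of `P` and `Q`: these lie in orthogonal linear subspaces, the origin is in
the relative interior of both, and `R` is the convex hull of their union. -/
def IsFreeSum [InnerProductSpace ℝ E] (P Q R : Set E) : Prop :=
  (∀ x ∈ P, ∀ y ∈ Q, inner ℝ x y = 0) ∧
    0 ∈ intrinsicInterior ℝ P ∧ 0 ∈ intrinsicInterior ℝ Q ∧ R = convexHull ℝ (P ∪ Q)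

/-- `R` is a free sum of a convex polygon with `n` vertices and a `(d-2)`-simplex. -/
def IsPolygonSimplexSum [InnerProductSpace ℝ E] (d n : ℕ) (R : Set E) : Prop :=
  ∃ C S : Set E, IsPolytopeOfDim 2 C ∧ (C.extremePoints ℝ).ncard = n ∧
    IsPolytopeOfDim (d - 2) S ∧ IsConvexSimplex S ∧ IsFreeSum C S R

/-- The simplicial `d`-polytope `P'` is obtained from the simplicial `d`-polytope `P` by a stellar
subdivision at a ridge, i.e. at a face of dimension `d - 2` (with `d - 1` vertices). As usual for
stellar subdivisions of polytopes, `P'` is determined up to combinatorial isomorphism. -/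
def IsRidgeSubdivision [NormedSpace ℝ E] (d : ℕ) (P P' : Set E) : Prop :=
  IsSimplicialPolytope d P ∧ IsSimplicialPolytope d P' ∧
    ∃ F ∈ (boundaryComplex P).faces, F.card + 1 = d ∧
      ((boundaryComplex P).stellarSubdivision F).IsIsomorphicTo (boundaryComplex P')

end Polytopes

/-! The free sum of an `n`-gon and a `(d-2)`-simplex has as boundary complex the join of an
`n`-cycle with the boundary of a `(d-2)`-simplex. It has `n + d - 1` vertices and `n + (d-1 choose
2) + n (d-1)` edges, so `n` cancels in `g₂`, which is `1`. This leaves the number of vertices free.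
A missing face of the join lies inside the cycle (at most three vertices) or is the vertex set of
the simplex (`d - 1` vertices), so none has `d` vertices.

A ridge `F` has link `{u, v}`. Its stellar subdivision adds one vertex `w`, joined to the `d - 1`
vertices of `F` and to `u`, `v`. No edge is lost, because `F` has at least three vertices. Hence
`g₂` grows by `(d + 1) - d = 1`. Primeness survives (`IsRidge.isPrimeComplex`), and exchanging a
vertex of `F` for `w` gives a ridge with the same link (`IsRidge.stellar`), so the step can be
repeated `b - 1` times.

On the geometric side, polytopes are hulls of finite sets `V` around the origin, and a face is a
subset on which a functional with `l ≤ 1` on `V` is constantly `1`. In this language a free sum is a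
join (`isPolarFace_union`), and a stellar subdivision is realized by adding the barycenter of `F`,
pushed slightly outwards (`exists_stellar`). The combinatorial arguments need only the predicate
`IsPolarFace V`, which `mem_faces_boundaryComplex` identifies with the boundary complex. -/

/-! ### Point configurations in convex position around the origin -/

section Configurations

open scoped Classical
open Topology

variable {E : Type*} [NormedAddCommGroup E] [NormedSpace ℝ E]

/-- The linear functionals that are at most `1` on `V`, i.e. the polar of `V`. -/
def IsPolar (V : Finset E) (l : E →L[ℝ] ℝ) : Prop :=
  ∀ v ∈ V, l v ≤ 1

/-- A (possibly empty) set of points of `V` on which some functional of the polar of `V` is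
constantly `1`. -/
def IsPolarFace (V s : Finset E) : Prop :=
  s ⊆ V ∧ ∃ l, IsPolar V l ∧ ∀ v ∈ s, l v = 1

/-- Every face is linearly independent and every point is a vertex. -/
structure IsSimplicialConfiguration (V : Finset E) : Prop where
  indep : ∀ s, IsPolarFace V s → LinearIndepOn ℝ id (s : Set E)
  vertex : ∀ v ∈ V, IsPolarFace V {v}

/-- A simplicial configuration whose positive hull is the whole space. -/
structure IsSpanningConfiguration (V : Finset E) : Prop extends IsSimplicialConfiguration V where
  pos : ∀ l : E →L[ℝ] ℝ, (∀ v ∈ V, l v ≤ 0) → l = 0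

lemma IsPolarFace.mono {V s t : Finset E} (h : IsPolarFace V s) (hts : t ⊆ s) :
    IsPolarFace V t :=
  ⟨hts.trans h.1, h.2.imp fun _ hl => ⟨hl.1, fun v hv => hl.2 v (hts hv)⟩⟩

lemma isPolarFace_empty (V : Finset E) : IsPolarFace V ∅ :=
  ⟨by simp, 0, fun v _ => by simp, by simp⟩

lemma LinearIndepOn.exists_dual_eq [FiniteDimensional ℝ E] {s : Set E}
    (hs : LinearIndepOn ℝ id s) (g : E → ℝ) : ∃ m : E →L[ℝ] ℝ, ∀ v ∈ s, m v = g v := by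
  have hs' : LinearIndependent ℝ ((↑) : s → E) := hs
  obtain ⟨m, hm⟩ := ((Module.Basis.span hs').constr ℝ (fun v : s => g v)).exists_extend
  refine ⟨LinearMap.toContinuousLinearMap m, fun v hv => ?_⟩
  have h1 : ((Module.Basis.span hs' ⟨v, hv⟩ : Submodule.span ℝ (Set.range ((↑) : s → E))) : E) = v :=
    congrArg Subtype.val (Module.Basis.span_apply hs' ⟨v, hv⟩)
  have h2 := LinearMap.congr_fun hm (Module.Basis.span hs' ⟨v, hv⟩)
  rw [Module.Basis.constr_basis] at h2
  simpa [h1] using h2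

/-- Every face is cut out by a functional of the polar. -/
lemma IsSimplicialConfiguration.exists_exact [FiniteDimensional ℝ E] {V s : Finset E}
    (hV : IsSimplicialConfiguration V) (hs : IsPolarFace V s) :
    ∃ l, IsPolar V l ∧ ∀ v ∈ V, l v = 1 ↔ v ∈ s := by
  obtain ⟨hsV, l, hl, hls⟩ := hs
  have hT : IsPolarFace V (V.filter fun v => l v = 1) :=
    ⟨Finset.filter_subset _ _, l, hl, fun v hv => (Finset.mem_filter.1 hv).2⟩
  -- By independence of the whole tight set of `l`, some `m` is `0` on `s` and `1` on the remaining
  -- tight points. Then `l - t • m` stays tight on `s` and drops below `1` on the others, while the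
  -- points that were not tight tolerate a small `t`.
  obtain ⟨m, hm⟩ := (hV.indep _ hT).exists_dual_eq fun v => if v ∈ s then 0 else 1
  have key : ∀ᶠ t : ℝ in 𝓝[>] 0, ∀ v ∈ V, l v < 1 → l v - t * m v < 1 := by
    rw [Filter.eventually_all_finset]
    intro v _
    by_cases hv : l v < 1
    · have : Filter.Tendsto (fun t : ℝ => l v - t * m v) (𝓝[>] 0) (𝓝 (l v - 0 * m v)) :=
        (Continuous.tendsto (by fun_prop) 0).mono_left nhdsWithin_le_nhds
      filter_upwards [this.eventually_lt_const (by simpa using hv)] with t ht _ using ht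
    · simp [hv]
  obtain ⟨t, ht, ht0⟩ := (key.and self_mem_nhdsWithin).exists
  have ht0 : 0 < t := ht0
  refine ⟨l - t • m, fun v hv => ?_, fun v hv => ?_⟩ <;>
  · rcases (hl v hv).lt_or_eq with h | h
    · have := ht v hv h
      have hvs : v ∉ s := fun h' => h.ne (hls v h')
      simp only [sub_apply, smul_apply, smul_eq_mul, hvs]
      grind
    · have h2 := hm v (by simp [hv, h])
      simp only [sub_apply, smul_apply, smul_eq_mul, h, h2]
      split_ifs with hvs <;> simp [hvs, ht0.le, ht0.ne']

lemma IsPolar.le_of_mem_convexHull {V : Finset E} {l : E →L[ℝ] ℝ} (hl : IsPolar V l) {x : E}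
    (hx : x ∈ convexHull ℝ (V : Set E)) : l x ≤ 1 :=
  convexHull_min (t := {y | l y ≤ 1}) hl
    (convex_halfSpace_le (LinearMap.isLinear l.toLinearMap) 1) hx

/-- The subset of a polytope where a functional of the polar takes the value `1`. -/
lemma IsPolar.convexHull_inter {V : Finset E} {l : E →L[ℝ] ℝ} (hl : IsPolar V l) :
    {x ∈ convexHull ℝ (V : Set E) | l x = 1} =
      convexHull ℝ ((V.filter fun v => l v = 1 : Finset E) : Set E) := by
  apply Set.Subset.antisymm
  · rintro x ⟨hx, hlx⟩
    obtain ⟨w, hw0, hw1, rfl⟩ := Finset.mem_convexHull'.1 hx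
    -- The weighted slacks are nonnegative and sum to `0`, so all the weight sits on tight points.
    have h0 : ∑ y ∈ V, w y * (1 - l y) = 0 := by
      simp only [mul_sub, mul_one, Finset.sum_sub_distrib, hw1]
      simp only [map_sum, map_smul, smul_eq_mul] at hlx
      linarith
    rw [Finset.sum_eq_zero_iff_of_nonneg fun y hy =>
      mul_nonneg (hw0 y hy) (sub_nonneg.2 (hl y hy))] at h0
    have hz : ∀ y ∈ V, ¬ l y = 1 → w y = 0 := fun y hy hne => by
      rcases mul_eq_zero.1 (h0 y hy) with h | h
      · exact h
      · exact absurd (by linarith) hne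
    refine Finset.mem_convexHull'.2 ⟨w, fun y hy => hw0 y (Finset.mem_filter.1 hy).1, ?_, ?_⟩
    · rw [Finset.sum_filter_of_ne, hw1]
      intro y hy hne
      by_contra h
      exact hne (hz y hy h)
    · rw [Finset.sum_filter_of_ne]
      intro y hy hne
      by_contra h
      exact hne (by rw [hz y hy h, zero_smul])
  · intro x hx
    refine ⟨convexHull_mono (Finset.coe_subset.2 (Finset.filter_subset _ _)) hx, ?_⟩
    exact convexHull_min (t := {y | l y = 1}) (by intro y hy; simpa using (Finset.mem_filter.1 hy).2)
      (convex_hyperplane (LinearMap.isLinear l.toLinearMap) 1) hx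

lemma IsSimplicialConfiguration.extremePoints_convexHull [FiniteDimensional ℝ E] {V : Finset E}
    (hV : IsSimplicialConfiguration V) : (convexHull ℝ (V : Set E)).extremePoints ℝ = V := by
  apply extremePoints_convexHull_subset.antisymm
  intro v hv
  obtain ⟨l, hl, hle⟩ := hV.exists_exact (hV.vertex v hv)
  have hlv : l v = 1 := (hle v hv).2 (by simp)
  apply exposedPoints_subset_extremePoints
  refine ⟨subset_convexHull ℝ _ hv, l, fun y hy => ⟨?_, fun h => ?_⟩⟩
  · rw [hlv]
    exact hl.le_of_mem_convexHull hy
  · have : y ∈ {x ∈ convexHull ℝ (V : Set E) | l x = 1} :=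
      ⟨hy, le_antisymm (hl.le_of_mem_convexHull hy) (hlv ▸ h)⟩
    rw [hl.convexHull_inter, show (V.filter fun v => l v = 1) = {v} by
      ext z; have := hle z; simp at this ⊢; grind] at this
    simpa using this

lemma LinearIndepOn.affineIndependent_coe {s : Set E} (hs : LinearIndepOn ℝ id s) :
    AffineIndependent ℝ ((↑) : s → E) :=
  affineIndependent_iff.2 fun t w _ hw =>
    linearIndependent_iff'.1 (show LinearIndependent ℝ ((↑) : s → E) from hs) t w hw

lemma IsSpanningConfiguration.nonempty [Nontrivial E] {V : Finset E}
    (hV : IsSpanningConfiguration V) : V.Nonempty := by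
  by_contra h
  rw [Finset.not_nonempty_iff_eq_empty] at h
  obtain ⟨x, hx⟩ := exists_ne (0 : E)
  obtain ⟨l, -, hl⟩ := exists_dual_vector ℝ x (norm_ne_zero_iff.2 hx)
  rw [hV.pos l (by simp [h])] at hl
  simp at hl
  exact hx (norm_eq_zero.1 hl.symm)

namespace IsSpanningConfiguration

variable [FiniteDimensional ℝ E] {V : Finset E}

/-- With empty interior, some nonzero functional would be constant on `V`, hence it or its negative
would be nonpositive there. Otherwise, a functional separating `0` from the interior is nonpositive
on `V`. Both contradict `pos`. -/
lemma zero_mem_interior [Nontrivial E] (hV : IsSpanningConfiguration V) :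
    (0 : E) ∈ interior (convexHull ℝ (V : Set E)) := by
  have hne : (interior (convexHull ℝ (V : Set E))).Nonempty := by
    rw [interior_convexHull_nonempty_iff_affineSpan_eq_top,
      AffineSubspace.affineSpan_eq_top_iff_vectorSpan_eq_top_of_nonempty ℝ E E hV.nonempty]
    by_contra h
    obtain ⟨f, hf, hle⟩ := Submodule.exists_le_ker_of_lt_top _ (lt_top_iff_ne_top.2 h)
    obtain ⟨v₀, hv₀⟩ := hV.nonempty
    have hc : ∀ v ∈ V, f v = f v₀ := fun v hv => by
      have := hle (vsub_mem_vectorSpan ℝ (Finset.mem_coe.2 hv) (Finset.mem_coe.2 hv₀))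
      simpa [sub_eq_zero] using this
    apply hf
    rcases le_total (f v₀) 0 with h0 | h0
    · have := hV.pos (LinearMap.toContinuousLinearMap f) fun v hv => by simpa [hc v hv] using h0
      ext x
      simpa using DFunLike.congr_fun this x
    · have := hV.pos (LinearMap.toContinuousLinearMap (-f)) fun v hv => by
        simpa [hc v hv] using h0
      ext x
      simpa using DFunLike.congr_fun this x
  by_contra h0
  have hconv := convex_convexHull ℝ (V : Set E)
  obtain ⟨f, hf⟩ := geometric_hahn_banach_open_point hconv.interior isOpen_interior h0
  have hle : ∀ v ∈ V, f v ≤ 0 := fun v hv => by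
    have h1 : v ∈ closure (interior (convexHull ℝ (V : Set E))) := by
      rw [hconv.closure_interior_eq_closure_of_nonempty_interior hne]
      exact subset_closure (subset_convexHull ℝ _ hv)
    refine closure_minimal (t := {y | f y ≤ 0}) (fun y hy => ?_)
      (isClosed_le f.continuous continuous_const) h1
    simpa using (hf y hy).le
  obtain ⟨x, hx⟩ := hne
  have := hf x hx
  simp [hV.pos f hle] at this

/-- The hull contains a ball of radius `r` around the origin, and `l ≤ 1` on it bounds the norm of
`l`. -/
lemma isCompact_polar [Nontrivial E] (hV : IsSpanningConfiguration V) :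
    IsCompact {l | IsPolar V l} := by
  obtain ⟨r, hr, hball⟩ := Metric.mem_nhds_iff.1 (mem_interior_iff_mem_nhds.1 hV.zero_mem_interior)
  have hclosed : IsClosed {l : E →L[ℝ] ℝ | IsPolar V l} := by
    simp only [IsPolar, Set.ofPred_forall]
    exact isClosed_biInter fun v _ => isClosed_le (by fun_prop) continuous_const
  refine Metric.isCompact_of_isClosed_isBounded hclosed
    (isBounded_iff_forall_norm_le.2 ⟨2 / r, fun l hl => ?_⟩)
  refine l.opNorm_le_bound (by positivity) fun x => ?_
  rcases eq_or_ne x 0 with rfl | hx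
  · simp
  have hx' : 0 < ‖x‖ := norm_pos_iff.2 hx
  have hb : ∀ σ : ℝ, |σ| = 1 → σ * l x ≤ 2 / r * ‖x‖ := fun σ hσ => by
    have hmem : (σ * (r / 2 / ‖x‖)) • x ∈ Metric.ball (0 : E) r := by
      rw [mem_ball_zero_iff, norm_smul, Real.norm_eq_abs, abs_mul, hσ,
        abs_of_pos (by positivity : 0 < r / 2 / ‖x‖), one_mul, div_mul_cancel₀ _ hx'.ne']
      linarith
    have := IsPolar.le_of_mem_convexHull hl (hball hmem)
    rw [map_smul, smul_eq_mul] at this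
    have h2 : σ * l x = (σ * (r / 2 / ‖x‖) * l x) * (2 / r * ‖x‖) := by field_simp
    rw [h2]
    exact mul_le_of_le_one_left (by positivity) this
  rw [Real.norm_eq_abs]
  exact abs_le'.2 ⟨by simpa using hb 1 (by simp), by simpa using hb (-1) (by simp)⟩

/-- A nonempty proper exposed face is cut out by a functional of the polar. -/
lemma exists_polar_of_isProperFace [Nontrivial E] (hV : IsSpanningConfiguration V) {F : Set E}
    (hF : IsProperFace (convexHull ℝ (V : Set E)) F) (hne : F.Nonempty) :
    ∃ l, IsPolar V l ∧ F = convexHull ℝ ((V.filter fun v => l v = 1 : Finset E) : Set E) := by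
  obtain ⟨l, hl⟩ := hF.1 hne
  obtain ⟨x, hx⟩ := hne
  have hx' := hx
  rw [hl] at hx'
  have hmem0 := interior_subset hV.zero_mem_interior
  -- The maximum of `l` is at least `l 0 = 0`. If it were `0`, then `l` would vanish by `pos` and
  -- the face would be everything. So `l` can be scaled to have maximum `1`.
  have hpos : 0 < l x := by
    refine lt_of_le_of_ne (by simpa using hx'.2 0 hmem0) fun h0 => hF.2 ?_
    have : l = 0 := hV.pos l fun v hv => h0 ▸ hx'.2 v (subset_convexHull ℝ _ hv)
    rw [hl, this]
    simp
  have hpol : IsPolar V ((l x)⁻¹ • l) := fun v hv => by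
    have := hx'.2 v (subset_convexHull ℝ _ hv)
    simp only [smul_apply, smul_eq_mul]
    rw [inv_mul_le_iff₀ hpos]
    simpa
  refine ⟨(l x)⁻¹ • l, hpol, ?_⟩
  rw [← hpol.convexHull_inter, hl]
  ext y
  simp only [Set.mem_ofPred_eq, smul_apply, smul_eq_mul, inv_mul_eq_one₀ hpos.ne']
  refine and_congr_right fun hy => ⟨fun h => le_antisymm (h x hx'.1) (hx'.2 y hy), fun h z hz => ?_⟩
  exact h ▸ hx'.2 z hz

lemma isProperFace_convexHull_filter [Nontrivial E] (hV : IsSpanningConfiguration V)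
    {l : E →L[ℝ] ℝ} (hl : IsPolar V l) :
    IsProperFace (convexHull ℝ (V : Set E))
      (convexHull ℝ ((V.filter fun v => l v = 1 : Finset E) : Set E)) := by
  rw [← hl.convexHull_inter]
  refine ⟨fun ⟨x, hx, hlx⟩ => ⟨l, ?_⟩, fun h => ?_⟩
  · ext y
    refine and_congr_right fun hy => ⟨fun h z hz => ?_, fun h => ?_⟩
    · rw [h]
      exact hl.le_of_mem_convexHull hz
    · exact le_antisymm (hl.le_of_mem_convexHull hy) (hlx ▸ h x hx)
  -- The face is proper since it misses the origin, where `l` is `0`.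
  · have h0 := interior_subset hV.zero_mem_interior
    rw [← h] at h0
    simpa using h0.2

lemma vectorSpan_convexHull_eq_top [Nontrivial E] (hV : IsSpanningConfiguration V) :
    vectorSpan ℝ (convexHull ℝ (V : Set E)) = ⊤ := by
  have h := interior_convexHull_nonempty_iff_affineSpan_eq_top.1 ⟨0, hV.zero_mem_interior⟩
  rw [← direction_affineSpan, affineSpan_convexHull, h, AffineSubspace.direction_top]

lemma isPolytopeOfDim [Nontrivial E] (hV : IsSpanningConfiguration V) {d : ℕ}
    (hd : Module.finrank ℝ E = d) : IsPolytopeOfDim d (convexHull ℝ (V : Set E)) :=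
  ⟨⟨V, hV.nonempty, rfl⟩, by rw [hV.vectorSpan_convexHull_eq_top, finrank_top, hd]⟩

lemma isSimplicialPolytope [Nontrivial E] (hV : IsSpanningConfiguration V) {d : ℕ}
    (hd : Module.finrank ℝ E = d) : IsSimplicialPolytope d (convexHull ℝ (V : Set E)) := by
  refine ⟨hV.isPolytopeOfDim hd, fun F hF => ?_⟩
  rcases F.eq_empty_or_nonempty with rfl | hne
  · exact ⟨∅, by simpa using affineIndependent_of_subsingleton ℝ _, by simp⟩
  obtain ⟨l, hl, rfl⟩ := hV.exists_polar_of_isProperFace hF hne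
  exact ⟨_, (hV.indep _ ⟨Finset.filter_subset _ _, l, hl,
    fun v hv => (Finset.mem_filter.1 hv).2⟩).affineIndependent_coe, rfl⟩

lemma mem_faces_boundaryComplex [Nontrivial E] (hV : IsSpanningConfiguration V) {s : Finset E} :
    s ∈ (boundaryComplex (convexHull ℝ (V : Set E))).faces ↔ s.Nonempty ∧ IsPolarFace V s := by
  refine and_congr_right fun hs => ⟨?_, ?_⟩
  · rintro ⟨F, hF, hsF⟩
    have hne : F.Nonempty := by
      obtain ⟨x, hx⟩ := hs
      exact ⟨x, (hsF hx).1⟩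
    obtain ⟨l, hl, rfl⟩ := hV.exists_polar_of_isProperFace hF hne
    have hsub := Finset.coe_subset.1 (hsF.trans extremePoints_convexHull_subset)
    exact ⟨hsub.trans (Finset.filter_subset _ _), l, hl,
      fun v hv => (Finset.mem_filter.1 (hsub hv)).2⟩
  · rintro ⟨hsV, l, hl, hls⟩
    refine ⟨_, hV.isProperFace_convexHull_filter hl, fun v hv => ?_⟩
    refine inter_extremePoints_subset_extremePoints_of_subset
      (convexHull_mono (Finset.coe_subset.2 (Finset.filter_subset _ _)))
      ⟨subset_convexHull ℝ _ (by simpa using ⟨hsV hv, hls v hv⟩), ?_⟩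
    rw [hV.extremePoints_convexHull]
    exact hsV hv

end IsSpanningConfiguration

end Configurations

/-! ### Stellar subdivisions of configurations -/

section StellarGeometry

open scoped Classical
open Topology

/-- The faces (including the empty one) of the stellar subdivision at `F` with new vertex `w`. -/
def IsStellarFace {α : Type*} (K : Finset α → Prop) (F : Finset α) (w : α) (s : Finset α) : Prop :=
  ¬ F ⊆ s ∧ ((w ∉ s ∧ K s) ∨ (w ∈ s ∧ K (s.erase w ∪ F)))

variable {E : Type*} [NormedAddCommGroup E] [NormedSpace ℝ E]

/-- The barycenter of `F`, pushed outwards by the factor `1 + t`. -/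
noncomputable def pushedBarycenter (F : Finset E) (t : ℝ) : E :=
  ((1 + t) / F.card) • ∑ x ∈ F, x

lemma map_pushedBarycenter (F : Finset E) (t : ℝ) (l : E →L[ℝ] ℝ) :
    l (pushedBarycenter F t) = (1 + t) * ((∑ x ∈ F, l x) / F.card) := by
  simp only [pushedBarycenter, map_smul, map_sum, smul_eq_mul]
  ring

/-- This decides whether `l` stays below `1` at the barycenter of `F`, and hence at the pushed point
for small `t`. -/
lemma IsPolar.average_lt_iff {V F : Finset E} {l : E →L[ℝ] ℝ} (hl : IsPolar V l) (hFV : F ⊆ V)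
    (hF : F.Nonempty) : (∑ x ∈ F, l x) / F.card < 1 ↔ ∃ x ∈ F, l x ≠ 1 := by
  have hc : (0 : ℝ) < F.card := by exact_mod_cast hF.card_pos
  rw [div_lt_one hc]
  constructor
  · intro h
    by_contra! h'
    rw [Finset.sum_congr rfl h'] at h
    simp at h
  · rintro ⟨x, hx, hne⟩
    simpa using Finset.sum_lt_sum (fun x hx => hl x (hFV hx)) ⟨x, hx, (hl x (hFV hx)).lt_of_ne hne⟩

lemma eventually_pushed_lt {a : ℝ} (ha : a < 1) : ∀ᶠ t : ℝ in 𝓝[>] 0, (1 + t) * a < 1 := by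
  have : Filter.Tendsto (fun t : ℝ => (1 + t) * a) (𝓝[>] 0) (𝓝 ((1 + 0) * a)) :=
    (Continuous.tendsto (by fun_prop) 0).mono_left nhdsWithin_le_nhds
  exact this.eventually_lt_const (by simpa using ha)

namespace IsSpanningConfiguration

variable [FiniteDimensional ℝ E] {V : Finset E}

/-- A functional tight exactly on `T` is below `1` somewhere on `F`, so a small push keeps it below
`1`. There are finitely many `T`, so one `t` serves them all. -/
lemma eventually_exact_lt (hV : IsSpanningConfiguration V) {F : Finset E} (hF : IsPolarFace V F)
    (hne : F.Nonempty) : ∀ᶠ t : ℝ in 𝓝[>] 0, ∀ T ∈ V.powerset, IsPolarFace V T → ¬ F ⊆ T →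
      ∃ l, IsPolar V l ∧ (∀ v ∈ T, l v = 1) ∧ l (pushedBarycenter F t) < 1 := by
  rw [Filter.eventually_all_finset]
  intro T _
  by_cases h : IsPolarFace V T ∧ ¬ F ⊆ T
  · obtain ⟨l, hl, hlT⟩ := hV.exists_exact h.1
    have hlt : (∑ x ∈ F, l x) / F.card < 1 := by
      rw [hl.average_lt_iff hF.1 hne]
      obtain ⟨x, hx, hxT⟩ := Finset.not_subset.1 h.2
      exact ⟨x, hx, fun h1 => hxT ((hlT x (hF.1 hx)).1 h1)⟩
    filter_upwards [eventually_pushed_lt hlt] with t ht _ _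
    exact ⟨l, hl, fun v hv => (hlT v (h.1.1 hv)).2 hv, by rwa [map_pushedBarycenter]⟩
  · exact Filter.Eventually.of_forall fun t h1 h2 => absurd ⟨h1, h2⟩ h

/-- Here `t` must work for all `l` tight on `T` at once. By compactness of the polar, the average
over `F` attains its maximum among them, and it is below `1` because `T ∪ F` is not a face. -/
lemma eventually_lt_of_not_face [Nontrivial E] (hV : IsSpanningConfiguration V) {F : Finset E}
    (hF : IsPolarFace V F) (hne : F.Nonempty) : ∀ᶠ t : ℝ in 𝓝[>] 0, ∀ T ∈ V.powerset,
      ¬ IsPolarFace V (T ∪ F) → ∀ l, IsPolar V l → (∀ v ∈ T, l v = 1) →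
        l (pushedBarycenter F t) < 1 := by
  rw [Filter.eventually_all_finset]
  intro T hT
  rw [Finset.mem_powerset] at hT
  by_cases h : IsPolarFace V (T ∪ F)
  · exact Filter.Eventually.of_forall fun t h1 => absurd h h1
  have hcl : IsClosed {l : E →L[ℝ] ℝ | ∀ v ∈ T, l v = 1} := by
    simp only [Set.ofPred_forall]
    exact isClosed_biInter fun v _ => isClosed_eq (by fun_prop) continuous_const
  have hcomp := hV.isCompact_polar.inter_right hcl
  rcases Set.eq_empty_or_nonempty ({l | IsPolar V l} ∩ {l | ∀ v ∈ T, l v = 1}) with he | hn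
  · refine Filter.Eventually.of_forall fun t _ l hl hlT => ?_
    exact absurd (show l ∈ {l | IsPolar V l} ∩ {l | ∀ v ∈ T, l v = 1} from ⟨hl, hlT⟩) (by simp [he])
  obtain ⟨l₀, ⟨hl₀, hl₀T⟩, hmax⟩ := hcomp.exists_isMaxOn hn
    (f := fun l : E →L[ℝ] ℝ => (∑ x ∈ F, l x) / F.card) (by fun_prop)
  have hlt : (∑ x ∈ F, l₀ x) / F.card < 1 := by
    rw [IsPolar.average_lt_iff hl₀ hF.1 hne]
    by_contra! hall
    refine h ⟨Finset.union_subset hT hF.1, l₀, hl₀, fun v hv => ?_⟩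
    rcases Finset.mem_union.1 hv with hv | hv
    exacts [hl₀T v hv, hall v hv]
  filter_upwards [eventually_pushed_lt hlt, self_mem_nhdsWithin] with t ht ht0 _ l hl hlT
  rw [map_pushedBarycenter]
  have ht0 : 0 < t := ht0
  exact lt_of_le_of_lt (mul_le_mul_of_nonneg_left (hmax ⟨hl, hlT⟩) (by linarith)) ht

/-- Functionals tight on `F` take the value `1 + t` at `w`, so `F` is cut off; faces not containing
`F` survive by `eventually_exact_lt`. Those `T` that span a face with `w` are controlled by
`eventually_lt_of_not_face` in one direction and by interpolation in the other. -/
lemma exists_stellar [Nontrivial E] (hV : IsSpanningConfiguration V) {F : Finset E}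
    (hF : IsPolarFace V F) (hcard : 2 ≤ F.card) :
    ∃ w ∉ V, IsSpanningConfiguration (insert w V) ∧
      ∀ s, IsPolarFace (insert w V) s ↔ IsStellarFace (IsPolarFace V) F w s := by
  have hne : F.Nonempty := Finset.card_pos.1 (by omega)
  obtain ⟨t, ⟨h1, h2⟩, ht0⟩ := (((hV.eventually_exact_lt hF hne).and
    (hV.eventually_lt_of_not_face hF hne)).and self_mem_nhdsWithin).exists
  have ht0 : 0 < t := ht0
  set w := pushedBarycenter F t with hw
  have hbig : ∀ l : E →L[ℝ] ℝ, (∀ x ∈ F, l x = 1) → l w = 1 + t := fun l hl => by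
    have : (F.card : ℝ) ≠ 0 := by exact_mod_cast hne.card_pos.ne'
    rw [hw, map_pushedBarycenter, Finset.sum_congr rfl hl]
    simp [this]
  have hwV : w ∉ V := fun h => by
    obtain ⟨-, l, hl, hlF⟩ := hF
    have := hl w h
    rw [hbig l hlF] at this
    linarith
  have hface : ∀ s, IsPolarFace (insert w V) s ↔ IsStellarFace (IsPolarFace V) F w s := by
    intro s
    constructor
    · rintro ⟨hs, l, hl, hls⟩
      have hlV : IsPolar V l := fun v hv => hl v (Finset.mem_insert_of_mem hv)
      refine ⟨fun hFs => ?_, ?_⟩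
      · have := hl w (Finset.mem_insert_self _ _)
        rw [hbig l fun x hx => hls x (hFs hx)] at this
        linarith
      · by_cases hws : w ∈ s
        · refine Or.inr ⟨hws, ?_⟩
          by_contra hnot
          have hsub : s.erase w ⊆ V := by
            intro x hx
            rw [Finset.mem_erase] at hx
            exact (Finset.mem_insert.1 (hs hx.2)).resolve_left hx.1
          have := h2 (s.erase w) (Finset.mem_powerset.2 hsub) hnot l hlV
            fun v hv => hls v (Finset.mem_of_mem_erase hv)
          exact this.ne (hls w hws)
        · exact Or.inl ⟨hws, fun x hx => (Finset.mem_insert.1 (hs hx)).resolve_left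
            (fun h => hws (h ▸ hx)), l, hlV, hls⟩
    · rintro ⟨hFs, ⟨hws, hs⟩ | ⟨hws, hs⟩⟩
      · obtain ⟨l, hl, hls, hlw⟩ := h1 s (Finset.mem_powerset.2 hs.1) hs hFs
        refine ⟨hs.1.trans (Finset.subset_insert _ _), l, fun v hv => ?_, hls⟩
        rcases Finset.mem_insert.1 hv with rfl | hv
        exacts [hlw.le, hl v hv]
      · have hT := hs.mono Finset.subset_union_left
        obtain ⟨l, hl, hlT, hlw⟩ := h1 (s.erase w) (Finset.mem_powerset.2 hT.1) hT
          fun h => hFs (h.trans (Finset.erase_subset _ _))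
        obtain ⟨-, m, hm, hmT⟩ := hs
        have hmw := hbig m fun x hx => hmT x (Finset.mem_union_right _ hx)
        have hd : 0 < 1 + t - l w := by linarith
        have ha : (t / (1 + t - l w)) + ((1 - l w) / (1 + t - l w)) = 1 := by
          field_simp; ring
        -- The functional `l` is below `1` at `w` and `m` equals `1 + t` there. Both are tight on
        -- `s.erase w`, and `a`, `b` are the weights for which the convex combination is exactly `1`
        -- at `w`.
        set a := t / (1 + t - l w) with haa
        set b := (1 - l w) / (1 + t - l w) with hbb
        have ha0 : 0 ≤ a := by positivity
        have hb0 : 0 ≤ b := div_nonneg (by linarith) hd.le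
        have hw1 : a * l w + b * m w = 1 := by
          rw [hmw, haa, hbb]
          field_simp
          ring
        refine ⟨fun x hx => ?_, a • l + b • m, fun v hv => ?_, fun v hv => ?_⟩
        · by_cases hxw : x = w
          · simp [hxw]
          · exact Finset.mem_insert_of_mem (hT.1 (Finset.mem_erase.2 ⟨hxw, hx⟩))
        · simp only [add_apply, smul_apply, smul_eq_mul]
          rcases Finset.mem_insert.1 hv with rfl | hv
          · exact hw1.le
          · nlinarith [mul_le_mul_of_nonneg_left (hl v hv) ha0,
              mul_le_mul_of_nonneg_left (hm v hv) hb0]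
        · simp only [add_apply, smul_apply, smul_eq_mul]
          by_cases hvw : v = w
          · rw [hvw, hw1]
          · have hv' := Finset.mem_erase.2 ⟨hvw, hv⟩
            rw [hlT v hv', hmT v (Finset.mem_union_left _ hv')]
            linarith
  have hnot : ∀ v, ¬ F ⊆ {v} := fun v h => by
    have := Finset.card_le_card h
    rw [Finset.card_singleton] at this
    omega
  refine ⟨w, hwV, ⟨⟨fun s hs => ?_, fun v hv => ?_⟩, fun l hl =>
    hV.pos l fun v hv => hl v (Finset.mem_insert_of_mem hv)⟩, hface⟩
  · obtain ⟨hFs, ⟨hws, hs⟩ | ⟨hws, hs⟩⟩ := (hface s).1 hs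
    · exact hV.indep s hs
    · have hind := hV.indep _ hs
      rw [← Finset.insert_erase hws, Finset.coe_insert,
        linearIndepOn_insert (by simp)]
      refine ⟨hind.mono (by simp), fun hspan => ?_⟩
      obtain ⟨x, hxF, hxs⟩ := Finset.not_subset.1 hFs
      -- For a vertex `x` of `F` outside `s`, this `m` vanishes on `s.erase w` but equals `(1 + t) /
      -- F.card` at `w`, so `w` is not in the span.
      obtain ⟨m, hm⟩ := hind.exists_dual_eq fun y => if y = x then 1 else 0
      have hm0 : Submodule.span ℝ (id '' ((s.erase w : Finset E) : Set E)) ≤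
          LinearMap.ker m.toLinearMap := by
        rw [Submodule.span_le]
        rintro _ ⟨y, hy, rfl⟩
        have hy' : y ∈ s.erase w := hy
        have := hm y (by exact_mod_cast Finset.mem_union_left F hy')
        have hyx : y ≠ x := fun h => hxs (h ▸ Finset.mem_of_mem_erase hy')
        simpa [hyx] using this
      have hmw : m w = 0 := by simpa using hm0 hspan
      have hc : (F.card : ℝ) ≠ 0 := by exact_mod_cast hne.card_pos.ne'
      rw [hw, map_pushedBarycenter, Finset.sum_congr rfl fun y hy =>
        hm y (by exact_mod_cast Finset.mem_union_right (s.erase w) hy)] at hmw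
      rw [Finset.sum_ite_eq' F x, if_pos hxF] at hmw
      have : (1 + t) ≠ 0 := by linarith
      simp [hc, this] at hmw
  · rw [hface]
    refine ⟨hnot v, ?_⟩
    rcases Finset.mem_insert.1 hv with rfl | hv
    · exact Or.inr ⟨by simp, by simpa using hF⟩
    · exact Or.inl ⟨by simpa using fun h : w = v => hwV (h ▸ hv), hV.vertex v hv⟩

lemma stellarSubdivision_isIsomorphicTo [Nontrivial E] (hV : IsSpanningConfiguration V)
    {F : Finset E} {w : E} (hF : IsPolarFace V F) (hwV : w ∉ V)
    (hV' : IsSpanningConfiguration (insert w V))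
    (hface : ∀ s, IsPolarFace (insert w V) s ↔ IsStellarFace (IsPolarFace V) F w s)
    (hne : F.Nonempty) :
    ((boundaryComplex (convexHull ℝ (V : Set E))).stellarSubdivision F).IsIsomorphicTo
      (boundaryComplex (convexHull ℝ ((insert w V : Finset E) : Set E))) := by
  have hmem : ∀ s : Finset (Option E),
      s ∈ ((boundaryComplex (convexHull ℝ (V : Set E))).stellarSubdivision F).faces ↔
        s.Nonempty ∧ ¬ F ⊆ s.eraseNone ∧ ((none ∉ s ∧ IsPolarFace V s.eraseNone) ∨
          (none ∈ s ∧ IsPolarFace V (F ∪ s.eraseNone))) := by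
    intro s
    simp only [PreAbstractSimplicialComplex.stellarSubdivision, Set.mem_ofPred_eq,
      hV.mem_faces_boundaryComplex]
    refine and_congr_right fun hs => and_congr_right fun _ => ?_
    by_cases hn : none ∈ s
    · simp [hn, hne.mono Finset.subset_union_left]
    · have : s.eraseNone.Nonempty := by
        obtain ⟨x, hx⟩ := hs
        cases x with
        | none => exact absurd hx hn
        | some x => exact ⟨x, Finset.mem_eraseNone.2 hx⟩
      simp [hn, this]
  have hsub : ∀ s ∈ ((boundaryComplex (convexHull ℝ (V : Set E))).stellarSubdivision F).faces,
      s.eraseNone ⊆ V := by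
    intro s hs
    obtain ⟨-, -, ⟨-, h⟩ | ⟨-, h⟩⟩ := (hmem s).1 hs
    · exact h.1
    · exact Finset.subset_union_right.trans h.1
  have himage : ∀ s : Finset (Option E), s.eraseNone ⊆ V →
      (s.image fun o => o.getD w).erase w = s.eraseNone ∧
        (w ∈ s.image (fun o => o.getD w) ↔ none ∈ s) := by
    intro s hs
    have hw : some w ∉ s := fun h => hwV (hs (Finset.mem_eraseNone.2 h))
    constructor
    · ext x
      simp only [Finset.mem_erase, Finset.mem_image, Finset.mem_eraseNone]
      constructor
      · rintro ⟨hxw, (_ | y), hy, rfl⟩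
        · simp at hxw
        · exact hy
      · intro hx
        exact ⟨fun h => hw (h ▸ hx), some x, hx, rfl⟩
    · simp only [Finset.mem_image]
      constructor
      · rintro ⟨(_ | y), hy, h⟩
        · exact hy
        · exact absurd ((show y = w from h) ▸ hy) hw
      · exact fun h => ⟨none, h, rfl⟩
  have hFw : w ∉ F := fun h => hwV (hF.1 h)
  have hsubiff : ∀ s : Finset E, F ⊆ s ↔ F ⊆ s.erase w := fun s => by
    rw [Finset.subset_erase]
    simp [hFw]
  -- The abstract new vertex `none` goes to `w`; old vertices are kept.
  refine ⟨fun o => o.getD w, ?_, ?_⟩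
  · rintro (_ | x) hx (_ | y) hy hxy
    · rfl
    · have := hsub _ hy (x := y) (by simp)
      exact absurd ((show w = y from hxy) ▸ this) hwV
    · have := hsub _ hx (x := x) (by simp)
      exact absurd ((show x = w from hxy) ▸ this) hwV
    · exact congrArg some hxy
  · have hiff : ∀ s : Finset (Option E), s.eraseNone ⊆ V →
        (s ∈ ((boundaryComplex (convexHull ℝ (V : Set E))).stellarSubdivision F).faces ↔
          s.image (fun o => o.getD w) ∈
            (boundaryComplex (convexHull ℝ ((insert w V : Finset E) : Set E))).faces) := by
      intro s hs
      obtain ⟨h1, h2⟩ := himage s hs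
      rw [hmem, hV'.mem_faces_boundaryComplex, hface, IsStellarFace,
        hsubiff (s.image fun o => o.getD w), h1, h2, Finset.image_nonempty, Finset.union_comm F]
      by_cases hn : none ∈ s
      · simp [hn]
      · have h3 : s.image (fun o => o.getD w) = s.eraseNone := by
          rw [← h1, Finset.erase_eq_of_notMem (by rwa [h2])]
        simp [hn, h3]
    ext t
    simp only [PreAbstractSimplicialComplex.map, Set.mem_image]
    constructor
    · rintro ⟨s, hs, rfl⟩
      exact (hiff s (hsub s hs)).1 hs
    · intro ht
      have htV := ((hV'.mem_faces_boundaryComplex).1 ht).2.1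
      have himg : ((t.image fun x => if x = w then none else some x).image
          fun o => o.getD w) = t := by
        rw [Finset.image_image]
        refine (Finset.image_congr fun x _ => ?_).trans Finset.image_id
        by_cases hx : x = w <;> simp [hx]
      refine ⟨t.image fun x => if x = w then none else some x, ?_, himg⟩
      rw [hiff, himg]
      · exact ht
      · intro x hx
        rw [Finset.mem_eraseNone, Finset.mem_image] at hx
        obtain ⟨y, hy, hyx⟩ := hx
        by_cases hyw : y = w
        · simp [hyw] at hyx
        · simp only [hyw, if_false, Option.some.injEq] at hyx
          subst hyx
          exact (Finset.mem_insert.1 (htV hy)).resolve_left hyw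

end IsSpanningConfiguration

end StellarGeometry

/-! ### Combinatorics of ridge subdivisions -/

section Combinatorics

open scoped Classical

variable {α : Type*}

/-- The edges of a complex on the vertex set `V`. -/
noncomputable def edgesOf (V : Finset α) (K : Finset α → Prop) : Finset (Finset α) :=
  (V.powersetCard 2).filter K

/-- `F` is a ridge of the complex `K` (with facets of size `d`) whose link is `{u, v}`. -/
structure IsRidge (d : ℕ) (K : Finset α → Prop) (F : Finset α) (u v : α) : Prop where
  face : K F
  card : F.card + 1 = d
  ne : u ≠ v
  left : u ∉ F
  right : v ∉ F
  link : ∀ z, K (insert z F) ↔ z ∈ F ∨ z = u ∨ z = v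

/-- The complex `K` (including the empty face) on the vertex set `V`, with faces of size at most
`d`, is prime: it has no missing face of size `d` and is not the boundary of a simplex. -/
structure IsPrimeComplex (d : ℕ) (V : Finset α) (K : Finset α → Prop) : Prop where
  down : ∀ s t, K s → t ⊆ s → K t
  sub : ∀ s, K s → s ⊆ V
  vert : ∀ v ∈ V, K {v}
  dim : ∀ s, K s → s.card ≤ d
  noMissing : ∀ G, (∀ x ∈ G, K (G.erase x)) → G ⊆ V → G.card = d → K G
  notSimplex : ∃ G, G ⊂ V ∧ ¬ K G

variable {V : Finset α} {K : Finset α → Prop} {F : Finset α} {u v w : α} {d : ℕ}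

/-- The first summand counts the surviving old edges. The second counts the edges `{w, x}`, with `x`
in the closed star of `F`. -/
lemma card_edgesOf_stellar (hK : ∀ s, K s → s ⊆ V) (hw : w ∉ V) (hFV : F ⊆ V) :
    (edgesOf (insert w V) (IsStellarFace K F w)).card =
      ((edgesOf V K).filter fun e => ¬ F ⊆ e).card +
        (V.filter fun x => ¬ F ⊆ {x} ∧ K (insert x F)).card := by
  have hFw : w ∉ F := fun h => hw (hFV h)
  rw [← Finset.card_image_of_injOn (s := V.filter fun x => ¬ F ⊆ {x} ∧ K (insert x F))
    (f := fun x => ({w, x} : Finset α)), ← Finset.card_union_of_disjoint]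
  · congr 1
    ext e
    simp only [edgesOf, Finset.mem_filter, Finset.mem_union, Finset.mem_image,
      Finset.mem_powersetCard, IsStellarFace]
    constructor
    · rintro ⟨⟨hsub, hcard⟩, hFe, ⟨hwe, he⟩ | ⟨hwe, he⟩⟩
      · exact Or.inl ⟨⟨⟨hK e he, hcard⟩, he⟩, hFe⟩
      · right
        have h1 : (e.erase w).card = 1 := by rw [Finset.card_erase_of_mem hwe, hcard]
        obtain ⟨x, hx⟩ := Finset.card_eq_one.1 h1
        have hex : e = {w, x} := by rw [← Finset.insert_erase hwe, hx]
        refine ⟨x, ⟨hK _ he (by simp [hx]), fun h => hFe (h.trans (by simp [hex])), ?_⟩, hex.symm⟩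
        rwa [hx, Finset.singleton_union] at he
    · rintro (⟨⟨⟨h1, h2⟩, h3⟩, h4⟩ | ⟨x, ⟨h1, h2, h3⟩, rfl⟩)
      · exact ⟨⟨h1.trans (Finset.subset_insert _ _), h2⟩, h4, Or.inl ⟨fun h => hw (h1 h), h3⟩⟩
      · have hwx : w ≠ x := fun h => hw (h ▸ h1)
        refine ⟨⟨?_, Finset.card_pair hwx⟩, ?_, Or.inr ⟨by simp, ?_⟩⟩
        · intro y
          simp only [Finset.mem_insert, Finset.mem_singleton]
          rintro (rfl | rfl) <;> simp [h1]
        · exact fun h => h2 (by rwa [Finset.subset_insert_iff_of_notMem hFw] at h)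
        · rwa [Finset.erase_insert (by simpa using hwx), Finset.singleton_union]
  · rw [Finset.disjoint_left]
    intro e he he'
    simp only [edgesOf, Finset.mem_filter, Finset.mem_image, Finset.mem_powersetCard] at he he'
    obtain ⟨x, -, rfl⟩ := he'
    exact hw (he.1.1.1 (by simp))
  · intro x hx y hy hxy
    have hxV : x ∈ V := (Finset.mem_filter.1 hx).1
    have hxw : x ≠ w := fun h => hw (h ▸ hxV)
    have : x ∈ ({w, y} : Finset α) := by
      rw [← show ({w, x} : Finset α) = {w, y} from hxy]
      simp
    simpa [hxw] using this

namespace IsRidge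

lemma card_edgesOf (hR : IsRidge d K F u v) (hd : 4 ≤ d) (hK : IsPrimeComplex d V K)
    (hw : w ∉ V) :
    (edgesOf (insert w V) (IsStellarFace K F w)).card = (edgesOf V K).card + (d + 1) := by
  have hc := hR.card
  rw [card_edgesOf_stellar hK.sub hw (hK.sub _ hR.face)]
  congr 1
  · congr 1
    apply Finset.filter_true_of_mem
    intro e he h
    have h2 := (Finset.mem_powersetCard.1 (Finset.mem_filter.1 he).1).2
    have := Finset.card_le_card h
    omega
  · have : (V.filter fun x => ¬ F ⊆ {x} ∧ K (insert x F)) = insert u (insert v F) := by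
      ext x
      simp only [Finset.mem_filter, Finset.mem_insert, hR.link]
      constructor
      · rintro ⟨-, -, h⟩
        tauto
      · intro h
        have h' : x ∈ F ∨ x = u ∨ x = v := by tauto
        refine ⟨hK.sub _ ((hR.link x).2 h') (by simp), fun hF => ?_, h'⟩
        have := Finset.card_le_card hF
        rw [Finset.card_singleton] at this
        omega
    rw [this, Finset.card_insert_of_notMem (by simp [hR.ne, hR.left]),
      Finset.card_insert_of_notMem hR.right]
    omega

/-- The new ridge is `F` with one vertex `x` exchanged for `w`. Adding `x` back would recreate `F`,
so the link is still `{u, v}`. -/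
lemma stellar (hR : IsRidge d K F u v) (hd : 4 ≤ d) (hK : IsPrimeComplex d V K) (hw : w ∉ V) :
    ∃ F', IsRidge d (IsStellarFace K F w) F' u v := by
  have hc := hR.card
  obtain ⟨x, hx⟩ : F.Nonempty := Finset.card_pos.1 (by omega)
  have hFV := hK.sub _ hR.face
  have hwF : w ∉ F := fun h => hw (hFV h)
  have huV : u ∈ V := hK.sub _ ((hR.link u).2 (by simp)) (by simp)
  have hvV : v ∈ V := hK.sub _ ((hR.link v).2 (by simp)) (by simp)
  have hwu : w ≠ u := fun h => hw (h ▸ huV)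
  have hwv : w ≠ v := fun h => hw (h ▸ hvV)
  have hnot : ∀ z, ¬ F ⊆ insert z (insert w (F.erase x)) ↔ z ≠ x := by
    intro z
    rw [not_iff_comm, not_not]
    constructor
    · rintro rfl y hy
      by_cases hyz : y = z <;> simp [hyz, hy]
    · intro h
      have := h hx
      simp only [Finset.mem_insert, Finset.mem_erase, ne_eq, not_true_eq_false, false_and,
        or_false] at this
      rcases this with h | h
      · exact h.symm
      · exact absurd (h ▸ hx) hwF
  have hwn : w ∉ F.erase x := fun h => hwF (Finset.mem_of_mem_erase h)
  have hlink : ∀ z, IsStellarFace K F w (insert z (insert w (F.erase x))) ↔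
      z ∈ insert w (F.erase x) ∨ z = u ∨ z = v := by
    intro z
    rw [IsStellarFace, hnot]
    simp only [Finset.mem_insert, Finset.mem_erase, true_or, or_true, not_true_eq_false, false_and,
      true_and, false_or]
    have hU : (insert z (insert w (F.erase x))).erase w ∪ F = if z = w then F else insert z F := by
      split_ifs with h
      · rw [h, Finset.insert_idem, Finset.erase_insert hwn]
        exact Finset.union_eq_right.2 (Finset.erase_subset _ _)
      · ext y
        simp only [Finset.mem_union, Finset.mem_erase, Finset.mem_insert]
        constructor
        · tauto
        · rintro (rfl | h')
          · exact Or.inl ⟨h, Or.inl rfl⟩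
          · exact Or.inr h'
    rw [hU]
    split_ifs with h
    · have : z ≠ x := fun h' => hwF (h ▸ h' ▸ hx)
      simp [h, hR.face]
      exact fun h' => hwF (h' ▸ hx)
    · rw [hR.link]
      have h1 : u ≠ x := fun h' => hR.left (h' ▸ hx)
      have h2 : v ≠ x := fun h' => hR.right (h' ▸ hx)
      constructor
      · tauto
      · rintro ((h' | h') | rfl | rfl)
        · exact absurd h' h
        · exact ⟨h'.1, Or.inl h'.2⟩
        · exact ⟨h1, by simp⟩
        · exact ⟨h2, by simp⟩
  refine ⟨insert w (F.erase x), ?_, ?_, hR.ne, ?_, ?_, hlink⟩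
  · have := (hlink w).2 (by simp)
    rwa [Finset.insert_idem] at this
  · rw [Finset.card_insert_of_notMem hwn, Finset.card_erase_of_mem hx]
    omega
  · simp [hwu.symm, hR.left]
  · simp [hwv.symm, hR.right]

/-- A missing `d`-set avoiding `w` would already be missing in `K`. For one containing `w`, the
other `d - 1` vertices turn out to lie in `F ∪ {u}` or in `F ∪ {v}`; as these are faces of `K`, the
set is a face after all. -/
lemma isPrimeComplex (hR : IsRidge d K F u v) (hd : 4 ≤ d) (hK : IsPrimeComplex d V K)
    (hw : w ∉ V) : IsPrimeComplex d (insert w V) (IsStellarFace K F w) := by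
  have hc := hR.card
  have hFV := hK.sub _ hR.face
  have hwF : w ∉ F := fun h => hw (hFV h)
  have hsing : ∀ x, ¬ F ⊆ {x} := fun x h => by
    have := Finset.card_le_card h
    rw [Finset.card_singleton] at this
    omega
  refine ⟨?_, ?_, ?_, ?_, ?_, ?_⟩
  · rintro s t ⟨hFs, h⟩ hts
    refine ⟨fun h => hFs (h.trans hts), ?_⟩
    by_cases hwt : w ∈ t
    · refine Or.inr ⟨hwt, ?_⟩
      rcases h with h | h
      · exact absurd (hts hwt) h.1
      · exact hK.down _ _ h.2 (Finset.union_subset_union_left (Finset.erase_subset_erase _ hts))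
    · refine Or.inl ⟨hwt, ?_⟩
      rcases h with h | h
      · exact hK.down _ _ h.2 hts
      · exact hK.down _ _ h.2
          ((Finset.subset_erase.2 ⟨hts, hwt⟩).trans Finset.subset_union_left)
  · rintro s ⟨-, h | h⟩
    · exact (hK.sub _ h.2).trans (Finset.subset_insert _ _)
    · rw [← Finset.insert_erase h.1]
      exact Finset.insert_subset_insert _ (Finset.subset_union_left.trans (hK.sub _ h.2))
  · intro x hx
    refine ⟨hsing x, ?_⟩
    by_cases hxw : w = x
    · subst hxw
      exact Or.inr ⟨by simp, by simpa using hR.face⟩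
    · exact Or.inl ⟨by simpa using hxw,
        hK.vert x ((Finset.mem_insert.1 hx).resolve_left (Ne.symm hxw))⟩
  · rintro s ⟨hFs, h | h⟩
    · exact hK.dim _ h.2
    · have h1 : s.erase w ⊂ s.erase w ∪ F := by
        refine Finset.ssubset_iff_subset_ne.2 ⟨Finset.subset_union_left, fun h' => hFs ?_⟩
        exact (Finset.union_eq_left.1 h'.symm).trans (Finset.erase_subset _ _)
      have h2 := Finset.card_lt_card h1
      have h3 := hK.dim _ h.2
      rw [Finset.card_erase_of_mem h.1] at h2
      omega
  · intro G hG hGV hGd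
    -- As `G` has more elements than `F`, one can delete a vertex outside `F` and would be left with
    -- a face containing `F`.
    have hFG : ¬ F ⊆ G := by
      intro h
      obtain ⟨x, hxG, hxF⟩ : ∃ x ∈ G, x ∉ F := by
        by_contra! h'
        have := Finset.card_le_card (show G ⊆ F from h')
        omega
      exact (hG x hxG).1 (Finset.subset_erase.2 ⟨h, hxF⟩)
    refine ⟨hFG, ?_⟩
    by_cases hwG : w ∈ G
    · refine Or.inr ⟨hwG, ?_⟩
      set T := G.erase w with hT
      have hTc : T.card + 1 = d := by rw [hT, Finset.card_erase_add_one hwG, hGd]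
      have hwT : w ∉ T := Finset.notMem_erase _ _
      have hTF : ∀ x ∈ T, K (T.erase x ∪ F) := by
        intro x hx
        have hxw : x ≠ w := fun h => hwT (h ▸ hx)
        have := (hG x (Finset.mem_of_mem_erase hx)).2
        rw [Finset.erase_right_comm] at this
        exact (this.resolve_left fun h => h.1 (by simp [hwG, hxw.symm])).2
      have hins : ∀ x ∈ T, ∀ y ∈ T, y ≠ x → y ∉ F → y = u ∨ y = v := by
        intro x hx y hy hyx hyF
        have : K (insert y F) := hK.down _ _ (hTF x hx) (by
          intro z hz
          rcases Finset.mem_insert.1 hz with rfl | hz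
          · simp [hyx, hy]
          · simp [hz])
        exact ((hR.link y).1 this).resolve_left hyF
      have huv : ¬ K (insert u (insert v F)) := by
        intro h
        have := hK.dim _ h
        rw [Finset.card_insert_of_notMem (by simp [hR.ne, hR.left]),
          Finset.card_insert_of_notMem hR.right] at this
        omega
      have hout : ∀ y ∈ T, y ∉ F → y = u ∨ y = v := by
        intro y hy hyF
        obtain ⟨x, hx, hxy⟩ : ∃ x ∈ T, x ≠ y := by
          apply Finset.exists_mem_ne
          omega
        exact hins x hx y hy hxy.symm hyF
      -- `T` has `d - 1 ≥ 3` elements. Deleting a third one would leave a face that together with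
      -- `F` contains the `d + 1` points of `F ∪ {u, v}`.
      have hnb : ¬ (u ∈ T ∧ v ∈ T) := by
        rintro ⟨hu, hv⟩
        obtain ⟨x, hx, hxu⟩ : ∃ x ∈ T, x ∉ ({u, v} : Finset α) := by
          by_contra! h'
          have := Finset.card_le_card (show T ⊆ {u, v} from h')
          rw [Finset.card_pair hR.ne] at this
          omega
        simp only [Finset.mem_insert, Finset.mem_singleton, not_or] at hxu
        apply huv
        refine hK.down _ _ (hTF x hx) ?_
        intro z hz
        simp only [Finset.mem_insert] at hz
        rcases hz with rfl | rfl | hz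
        · simp [Ne.symm hxu.1, hu]
        · simp [Ne.symm hxu.2, hv]
        · simp [hz]
      rcases not_and_or.1 hnb with h | h
      · refine hK.down _ _ ((hR.link v).2 (by simp)) (Finset.union_subset (fun y hy => ?_)
          (Finset.subset_insert _ _))
        by_cases hyF : y ∈ F
        · exact Finset.mem_insert_of_mem hyF
        · rcases hout y hy hyF with rfl | rfl
          · exact absurd hy h
          · simp
      · refine hK.down _ _ ((hR.link u).2 (by simp)) (Finset.union_subset (fun y hy => ?_)
          (Finset.subset_insert _ _))
        by_cases hyF : y ∈ F
        · exact Finset.mem_insert_of_mem hyF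
        · rcases hout y hy hyF with rfl | rfl
          · simp
          · exact absurd hy h
    · refine Or.inl ⟨hwG, hK.noMissing G (fun x hx => ?_) ?_ hGd⟩
      · exact ((hG x hx).2.resolve_right fun h => hwG (Finset.mem_of_mem_erase h.1)).2
      · exact fun x hx => (Finset.mem_insert.1 (hGV hx)).resolve_left fun h => hwG (h ▸ hx)
  -- The subdivided ridge itself is the proper subset that is no longer a face.
  · refine ⟨F, ?_, fun h => h.1 subset_rfl⟩
    exact (Finset.ssubset_iff_of_subset (hFV.trans (Finset.subset_insert _ _))).2
      ⟨w, by simp, hwF⟩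

end IsRidge

end Combinatorics

/-! ### Simplices and polygons -/

section SimplexAndPolygon

open scoped Classical

variable {E : Type*} [NormedAddCommGroup E] [NormedSpace ℝ E] [FiniteDimensional ℝ E]

/-- The vertices are a basis and minus its sum. The only linear relations among them have constant
coefficients, so omitting any vertex leaves an independent set. -/
lemma exists_spanning_simplex {k : ℕ} (hk : 1 ≤ k) (hE : Module.finrank ℝ E = k) :
    ∃ V : Finset E, IsSpanningConfiguration V ∧ V.card = k + 1 ∧
      (∀ s, IsPolarFace V s ↔ s ⊂ V) ∧ AffineIndependent ℝ ((↑) : V → E) := by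
  obtain ⟨b⟩ : Nonempty (Module.Basis (Fin k) ℝ E) := ⟨Module.finBasisOfFinrankEq ℝ E hE⟩
  set v : Option (Fin k) → E := fun o => o.elim (-∑ i, b i) b with hv
  have hkey : ∀ c : Option (Fin k) → ℝ, ∑ o, c o • v o = 0 → ∀ o p, c o = c p := by
    intro c hc
    have h1 : ∑ i, (c (some i) - c none) • b i = 0 := by
      rw [Fintype.sum_option] at hc
      simp only [sub_smul, Finset.sum_sub_distrib, ← Finset.smul_sum]
      simp only [hv, Option.elim, smul_neg] at hc
      rw [← hc]
      abel
    have h2 := Fintype.linearIndependent_iff.1 b.linearIndependent _ h1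
    have h3 : ∀ o, c o = c none := by
      rintro (_ | i)
      · rfl
      · linarith [h2 i]
    intro o p
    rw [h3 o, h3 p]
  have hkey' : ∀ (t : Finset (Option (Fin k))) (c : Option (Fin k) → ℝ), ∑ o ∈ t, c o • v o = 0 →
      ∀ o ∈ t, ∀ p, c o = if p ∈ t then c p else 0 := by
    intro t c hc o ho p
    have := hkey (fun o => if o ∈ t then c o else 0) (by simpa [ite_smul] using hc) o p
    simpa [ho] using this
  have hinj : Function.Injective v := by
    intro o p hop
    by_contra hne
    have h := hkey' {o, p} (fun q => if q = o then 1 else -1)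
      (by rw [Finset.sum_pair hne]; simp [Ne.symm hne, hop]) o (by simp) p
    simp [Ne.symm hne] at h
    norm_num at h
  have hind : ∀ p, LinearIndepOn ℝ v {o | o ≠ p} := fun p => by
    rw [linearIndepOn_iff']
    intro t g ht hg o ho
    have hp : p ∉ t := fun h => ht h rfl
    rw [hkey' t g hg o ho p, if_neg hp]
  have hsum : ∀ l : E →L[ℝ] ℝ, l (v none) + ∑ i, l (v (some i)) = 0 := fun l => by
    simp [hv]
  have hsum' : ∀ l : E →L[ℝ] ℝ, ∑ o, l (v o) = 0 := fun l => by
    rw [Fintype.sum_option, hsum]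
  set V : Finset E := Finset.univ.image v with hVdef
  have hVcoe : (V : Set E) = Set.range v := by simp [hVdef]
  have hcard : V.card = k + 1 := by
    rw [hVdef, Finset.card_image_of_injective _ hinj]
    simp
  have hmiss : ∀ s : Finset E, s ⊂ V → ∃ p, (s : Set E) ⊆ v '' {o | o ≠ p} := by
    intro s hs
    obtain ⟨x, hx, hxs⟩ := Finset.exists_of_ssubset hs
    obtain ⟨p, -, rfl⟩ := Finset.mem_image.1 hx
    refine ⟨p, fun y hy => ?_⟩
    obtain ⟨o, -, rfl⟩ := Finset.mem_image.1 (hs.1 hy)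
    exact ⟨o, fun h => hxs (h ▸ hy), rfl⟩
  have hface : ∀ s, IsPolarFace V s ↔ s ⊂ V := by
    intro s
    constructor
    · rintro ⟨hsV, l, -, hls⟩
      refine hsV.ssubset_of_ne fun h => ?_
      have := hsum' l
      rw [Finset.sum_congr rfl fun o _ => hls (v o) (h ▸ Finset.mem_image_of_mem v (Finset.mem_univ o))]
        at this
      simp at this
      linarith
    · intro hs
      obtain ⟨p, hp⟩ := hmiss s hs
      -- Set `l` to `1` on all vertices but `p`. As the vertices sum to `0`, its value at `p` is
      -- then nonpositive.
      obtain ⟨l, hl⟩ := (hind p).id_image.exists_dual_eq fun _ => 1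
      have h1 : ∀ o, o ≠ p → l (v o) = 1 := fun o ho => hl _ ⟨o, ho, rfl⟩
      refine ⟨hs.1, l, fun y hy => ?_, fun y hy => hl y (hp hy)⟩
      obtain ⟨o, -, rfl⟩ := Finset.mem_image.1 hy
      by_cases ho : o = p
      · subst ho
        have h2 := hsum' l
        rw [← Finset.add_sum_erase _ _ (Finset.mem_univ o), Finset.sum_congr rfl fun q hq =>
          h1 q (Finset.ne_of_mem_erase hq)] at h2
        have h3 : (0 : ℝ) ≤ ∑ x ∈ Finset.univ.erase o, 1 := Finset.sum_nonneg fun _ _ => by simp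
        linarith
      · exact (h1 o ho).le
  refine ⟨V, ⟨⟨fun s hs => ?_, fun x hx => ?_⟩, fun l hl => ?_⟩, hcard, hface, ?_⟩
  · obtain ⟨p, hp⟩ := hmiss s ((hface s).1 hs)
    exact (hind p).id_image.mono hp
  · rw [hface]
    refine (Finset.singleton_subset_iff.2 hx).ssubset_of_ne fun h => ?_
    rw [← h, Finset.card_singleton] at hcard
    omega
  · have h0 := (Finset.sum_eq_zero_iff_of_nonpos fun o _ =>
      hl (v o) (Finset.mem_image_of_mem v (Finset.mem_univ o))).1 (hsum' l)
    have : l.toLinearMap = 0 := b.ext fun i => by simpa [hv] using h0 (some i) (Finset.mem_univ _)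
    ext x
    simpa using LinearMap.congr_fun this x
  · have hv : AffineIndependent ℝ v := affineIndependent_iff.2 fun t w hw0 hw o ho => by
      by_cases ht : ∃ p, p ∉ t
      · obtain ⟨p, hp⟩ := ht
        rw [hkey' t w hw o ho p, if_neg hp]
      · push Not at ht
        rw [Finset.sum_congr rfl (g := fun _ => w o) fun p hp => by
          rw [hkey' t w hw p hp o, if_pos ho]] at hw0
        rw [Finset.sum_const, smul_eq_zero] at hw0
        exact hw0.resolve_left (Finset.card_ne_zero_of_mem ho)
    have := hv.range
    rw [← hVcoe] at this
    exact this

/-- Start from a triangle and subdivide an edge repeatedly: each time one edge is replaced by two.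
-/
lemma exists_spanning_polygon (hE : Module.finrank ℝ E = 2) (n : ℕ) (hn : 3 ≤ n) :
    ∃ V : Finset E, IsSpanningConfiguration V ∧ V.card = n ∧
      (∀ s, IsPolarFace V s → s.card ≤ 2) ∧ (edgesOf V (IsPolarFace V)).card = n := by
  have : Nontrivial E := Module.nontrivial_of_finrank_pos (R := ℝ) (by omega)
  induction n, hn using Nat.le_induction with
  | base =>
    obtain ⟨V, hV, hcard, hface, -⟩ := exists_spanning_simplex (by norm_num) hE
    refine ⟨V, hV, hcard, fun s hs => ?_, ?_⟩
    · have := Finset.card_lt_card ((hface s).1 hs)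
      omega
    · rw [edgesOf, Finset.filter_true_of_mem, Finset.card_powersetCard, hcard]
      · rfl
      · intro s hs
        obtain ⟨h1, h2⟩ := Finset.mem_powersetCard.1 hs
        refine (hface s).2 (h1.ssubset_of_ne fun h => ?_)
        rw [h] at h2
        omega
  | succ n hn ih =>
    obtain ⟨V, hV, hcard, hdim, hedges⟩ := ih
    obtain ⟨F, hF⟩ : (edgesOf V (IsPolarFace V)).Nonempty := Finset.card_pos.1 (by omega)
    have hF' := hF
    simp only [edgesOf, Finset.mem_filter, Finset.mem_powersetCard] at hF'
    obtain ⟨⟨-, hF2⟩, hFface⟩ := hF'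
    obtain ⟨w, hw, hV', hface⟩ := hV.exists_stellar hFface hF2.ge
    refine ⟨insert w V, hV', by rw [Finset.card_insert_of_notMem hw, hcard], fun s hs => ?_, ?_⟩
    · obtain ⟨hFs, h | h⟩ := (hface s).1 hs
      · exact hdim _ h.2
      · have h1 : s.erase w ⊂ s.erase w ∪ F := by
          refine Finset.ssubset_iff_subset_ne.2 ⟨Finset.subset_union_left, fun h' => hFs ?_⟩
          exact (Finset.union_eq_left.1 h'.symm).trans (Finset.erase_subset _ _)
        have h2 := Finset.card_lt_card h1
        have h3 := hdim _ h.2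
        rw [Finset.card_erase_of_mem h.1] at h2
        omega
    · rw [show IsPolarFace (insert w V) = IsStellarFace (IsPolarFace V) F w from
        funext fun s => propext (hface s), card_edgesOf_stellar (fun s hs => hs.1) hw hFface.1]
      have h1 : (edgesOf V (IsPolarFace V)).filter (fun e => ¬ F ⊆ e) =
          (edgesOf V (IsPolarFace V)).erase F := by
        ext e
        simp only [Finset.mem_filter, Finset.mem_erase]
        rw [and_comm]
        refine and_congr_left fun he => not_congr ⟨fun h => ?_, fun h => h ▸ subset_rfl⟩
        have := (Finset.mem_powersetCard.1 (Finset.mem_filter.1 he).1).2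
        exact (Finset.eq_of_subset_of_card_le h (by omega)).symm
      have h2 : V.filter (fun x => ¬ F ⊆ {x} ∧ IsPolarFace V (insert x F)) = F := by
        ext x
        simp only [Finset.mem_filter]
        constructor
        · rintro ⟨-, -, h⟩
          by_contra hx
          have := hdim _ h
          rw [Finset.card_insert_of_notMem hx] at this
          omega
        · intro hx
          refine ⟨hFface.1 hx, fun h => ?_, by rwa [Finset.insert_eq_of_mem hx]⟩
          have := Finset.card_le_card h
          rw [Finset.card_singleton] at this
          omega
      rw [h1, h2, Finset.card_erase_of_mem hF, hedges, hF2]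
      omega

end SimplexAndPolygon

/-! ### Joins -/

section Join

open scoped Classical

variable {α : Type*} {A B : Finset α} {K KA : Finset α → Prop}

/-- The edges of the join of a complex `KA` on `A` with the boundary of a simplex with vertex set
`B`. -/
lemma card_edgesOf_join (hAB : Disjoint A B) (hKA : ∀ s, KA s → s ⊆ A) (h0 : KA ∅)
    (hvert : ∀ a ∈ A, KA {a}) (hB : 3 ≤ B.card)
    (hK : ∀ s, K s ↔ s ⊆ A ∪ B ∧ KA (s ∩ A) ∧ s ∩ B ⊂ B) :
    (edgesOf (A ∪ B) K).card = (edgesOf A KA).card + B.card.choose 2 + A.card * B.card := by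
  have hA' : ∀ a ∈ A, a ∉ B := fun a ha hb => Finset.disjoint_left.1 hAB ha hb
  -- The condition on `B` is void for edges because `B` has at least three points.
  have hlt : ∀ s : Finset α, s.card ≤ 2 → s ∩ B ⊂ B := fun s hs =>
    Finset.inter_subset_right.ssubset_of_ne fun h => by
      have := Finset.card_le_card (Finset.inter_subset_left (s₁ := s) (s₂ := B))
      rw [h] at this
      omega
  have hunion : edgesOf (A ∪ B) K = (edgesOf A KA ∪ B.powersetCard 2) ∪
      (A ×ˢ B).image fun p => {p.1, p.2} := by
    ext e
    simp only [edgesOf, Finset.mem_filter, Finset.mem_union, Finset.mem_powersetCard,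
      Finset.mem_image, Finset.mem_product, Prod.exists, hK]
    constructor
    · rintro ⟨⟨hsub, hcard⟩, -, hKe, -⟩
      obtain ⟨x, y, hxy, rfl⟩ := Finset.card_eq_two.1 hcard
      have hx := Finset.mem_union.1 (hsub (show x ∈ ({x, y} : Finset α) by simp))
      have hy := Finset.mem_union.1 (hsub (show y ∈ ({x, y} : Finset α) by simp))
      rcases hx with hx | hx <;> rcases hy with hy | hy
      · have hs : ({x, y} : Finset α) ⊆ A := by
          intro z; simp only [Finset.mem_insert, Finset.mem_singleton]; rintro (rfl | rfl) <;> assumption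
        rw [Finset.inter_eq_left.2 hs] at hKe
        exact Or.inl (Or.inl ⟨⟨hs, hcard⟩, hKe⟩)
      · exact Or.inr ⟨x, y, ⟨hx, hy⟩, rfl⟩
      · exact Or.inr ⟨y, x, ⟨hy, hx⟩, Finset.pair_comm _ _⟩
      · have hs : ({x, y} : Finset α) ⊆ B := by
          intro z; simp only [Finset.mem_insert, Finset.mem_singleton]; rintro (rfl | rfl) <;> assumption
        exact Or.inl (Or.inr ⟨hs, hcard⟩)
    · rintro ((⟨⟨hs, hc⟩, hKe⟩ | ⟨hs, hc⟩) | ⟨x, y, ⟨hx, hy⟩, rfl⟩)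
      · have hs' := hs.trans (Finset.subset_union_left (s₂ := B))
        exact ⟨⟨hs', hc⟩, hs', by rwa [Finset.inter_eq_left.2 hs], hlt _ hc.le⟩
      · have hs' := hs.trans (Finset.subset_union_right (s₁ := A))
        refine ⟨⟨hs', hc⟩, hs', ?_, hlt _ hc.le⟩
        rwa [Finset.disjoint_iff_inter_eq_empty.1 (hAB.symm.mono_left hs)]
      · have hc : ({x, y} : Finset α).card = 2 := Finset.card_pair fun h => hA' x hx (h ▸ hy)
        have hs' : ({x, y} : Finset α) ⊆ A ∪ B := by
          intro z
          simp only [Finset.mem_insert, Finset.mem_singleton, Finset.mem_union]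
          rintro (rfl | rfl) <;> simp [*]
        refine ⟨⟨hs', hc⟩, hs', ?_, hlt _ hc.le⟩
        have : ({x, y} : Finset α) ∩ A = {x} := by
          rw [Finset.insert_inter_of_mem hx, Finset.singleton_inter_of_notMem fun h => hA' y h hy]
          rfl
        rw [this]
        exact hvert x hx
  rw [hunion, Finset.card_union_of_disjoint, Finset.card_union_of_disjoint,
    Finset.card_powersetCard, Finset.card_image_of_injOn, Finset.card_product]
  · rintro ⟨x, y⟩ hxy ⟨x', y'⟩ hxy' h
    simp only [Finset.coe_product, Set.mem_prod, Finset.mem_coe] at hxy hxy'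
    have h' : ({x, y} : Finset α) = {x', y'} := h
    have hx : x ∈ ({x', y'} : Finset α) := h' ▸ by simp
    have hy : y ∈ ({x', y'} : Finset α) := h' ▸ by simp
    simp only [Finset.mem_insert, Finset.mem_singleton] at hx hy
    have hx' : x = x' := hx.resolve_right fun h => hA' x hxy.1 (h ▸ hxy'.2)
    have hy' : y = y' := hy.resolve_left fun h => hA' y (h ▸ hxy'.1) hxy.2
    rw [hx', hy']
  · rw [Finset.disjoint_left]
    intro e he he'
    have hs := hKA e (Finset.mem_filter.1 he).2
    obtain ⟨hs', hc⟩ := Finset.mem_powersetCard.1 he'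
    obtain ⟨x, hx⟩ : e.Nonempty := Finset.card_pos.1 (by omega)
    exact hA' x (hs hx) (hs' hx)
  · rw [Finset.disjoint_left]
    intro e he he'
    obtain ⟨⟨x, y⟩, hxy, rfl⟩ := Finset.mem_image.1 he'
    obtain ⟨hx, hy⟩ := Finset.mem_product.1 hxy
    rcases Finset.mem_union.1 he with he | he
    · exact hA' y (hKA _ (Finset.mem_filter.1 he).2 (by simp)) hy
    · exact hA' x hx ((Finset.mem_powersetCard.1 he).1 (by simp))

variable {d : ℕ}

lemma isPrimeComplex_join (hd : 4 ≤ d) (hAB : Disjoint A B) (h0 : KA ∅)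
    (hdown : ∀ s t, KA s → t ⊆ s → KA t)
    (hvert : ∀ a ∈ A, KA {a}) (hdim : ∀ s, KA s → s.card ≤ 2) (hA : A.Nonempty)
    (hB : B.card + 1 = d) (hK : ∀ s, K s ↔ s ⊆ A ∪ B ∧ KA (s ∩ A) ∧ s ∩ B ⊂ B) :
    IsPrimeComplex d (A ∪ B) K := by
  have hBA : B ∩ A = ∅ := Finset.disjoint_iff_inter_eq_empty.1 hAB.symm
  have hlt : ∀ s : Finset α, s.card + 1 < d → s ∩ B ⊂ B := fun s hs =>
    Finset.inter_subset_right.ssubset_of_ne fun h => by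
      have := Finset.card_le_card (Finset.inter_subset_left (s₁ := s) (s₂ := B))
      rw [h] at this
      omega
  have hsplit : ∀ s, s ⊆ A ∪ B → s.card = (s ∩ A).card + (s ∩ B).card := fun s hs => by
    rw [← Finset.card_union_of_disjoint (hAB.mono Finset.inter_subset_right
      Finset.inter_subset_right), ← Finset.inter_union_distrib_left, Finset.inter_eq_left.2 hs]
  refine ⟨?_, fun s hs => ((hK s).1 hs).1, ?_, ?_, ?_, ?_⟩
  · intro s t hs hts
    rw [hK] at hs ⊢
    exact ⟨hts.trans hs.1, hdown _ _ hs.2.1 (Finset.inter_subset_inter_right hts),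
      (Finset.inter_subset_inter_right hts).trans_ssubset hs.2.2⟩
  · intro x hx
    rw [hK]
    refine ⟨Finset.singleton_subset_iff.2 hx, ?_, hlt _ (by simp; omega)⟩
    by_cases hxA : x ∈ A
    · rw [Finset.singleton_inter_of_mem hxA]
      exact hvert x hxA
    · rwa [Finset.singleton_inter_of_notMem hxA]
  · intro s hs
    obtain ⟨h1, h2, h3⟩ := (hK s).1 hs
    have := hsplit s h1
    have := hdim _ h2
    have := Finset.card_lt_card h3
    omega
  · intro G hG hGV hGd
    by_contra hnot
    have hproper : ∀ t, t ⊆ G → t ≠ G → K t := fun t ht hne => by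
      obtain ⟨x, hx, hxt⟩ := Finset.exists_of_ssubset (ht.ssubset_of_ne hne)
      have h1 := hG x hx
      rw [hK] at h1 ⊢
      have hts : t ⊆ G.erase x := Finset.subset_erase.2 ⟨ht, hxt⟩
      exact ⟨hts.trans h1.1, hdown _ _ h1.2.1 (Finset.inter_subset_inter_right hts),
        (Finset.inter_subset_inter_right hts).trans_ssubset h1.2.2⟩
    rw [hK, not_and, not_and_or] at hnot
    -- A minimal non-face fails in only one factor. In `A` its size is at most `3 < d`; in `B` it is
    -- `B` itself, of size `d - 1`.
    rcases hnot hGV with h | h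
    · have hGA : G ∩ A = G := by
        by_contra hne
        have := ((hK _).1 (hproper _ Finset.inter_subset_left hne)).2.1
        rw [Finset.inter_assoc, Finset.inter_self] at this
        exact h this
      obtain ⟨x, hx⟩ : G.Nonempty := Finset.card_pos.1 (by omega)
      have h1 := hdim _ ((hK _).1 (hG x hx)).2.1
      rw [Finset.inter_eq_left.2 ((Finset.erase_subset _ _).trans (Finset.inter_eq_left.1 hGA)),
        Finset.card_erase_of_mem hx] at h1
      omega
    · have hGB : G ∩ B = B := by
        by_contra hne
        exact h (Finset.inter_subset_right.ssubset_of_ne hne)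
      have hBG : B ≠ G := fun h' => by
        rw [h'] at hB
        omega
      have := ((hK _).1 (hproper B (Finset.inter_eq_right.1 hGB) hBG)).2.2
      rw [Finset.inter_self] at this
      exact this.ne rfl
  · refine ⟨B, ?_, fun h => ((hK B).1 h).2.2.ne (Finset.inter_self B)⟩
    obtain ⟨a, ha⟩ := hA
    exact (Finset.ssubset_iff_of_subset Finset.subset_union_right).2
      ⟨a, Finset.mem_union_left _ ha, Finset.disjoint_left.1 hAB ha⟩

/-- Take an edge of `KA` together with `B` minus two points `u`, `v`. The edge is already a maximal
face of `KA`, so only `u` or `v` can be added. -/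
lemma exists_isRidge_join (hd : 4 ≤ d) (hAB : Disjoint A B) (hKA : ∀ s, KA s → s ⊆ A)
    (hdim : ∀ s, KA s → s.card ≤ 2) (hB : B.card + 1 = d)
    (hK : ∀ s, K s ↔ s ⊆ A ∪ B ∧ KA (s ∩ A) ∧ s ∩ B ⊂ B) {e : Finset α} (he : KA e)
    (hecard : e.card = 2) : ∃ F u v, IsRidge d K F u v := by
  obtain ⟨u, hu, v, hv, huv⟩ := Finset.one_lt_card.1 (show 1 < B.card by omega)
  have hA' : ∀ a ∈ A, a ∉ B := fun a ha hb => Finset.disjoint_left.1 hAB ha hb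
  have heA := hKA e he
  set C := (B.erase u).erase v with hC
  have hCB : C ⊆ B := (Finset.erase_subset _ _).trans (Finset.erase_subset _ _)
  have huC : u ∉ C := by simp [hC]
  have hvC : v ∉ C := by simp [hC]
  have hue : u ∉ e := fun h => hA' u (heA h) hu
  have hve : v ∉ e := fun h => hA' v (heA h) hv
  have hCcard : C.card + 2 = B.card := by
    rw [hC, Finset.card_erase_of_mem (by simp [hv, huv.symm]), Finset.card_erase_of_mem hu]
    omega
  have hdis : Disjoint e C := hAB.mono heA hCB
  have hFA : (e ∪ C) ∩ A = e := by
    rw [Finset.union_inter_distrib_right, Finset.inter_eq_left.2 heA,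
      Finset.disjoint_iff_inter_eq_empty.1 (hAB.symm.mono_left hCB), Finset.union_empty]
  have hFB : (e ∪ C) ∩ B = C := by
    rw [Finset.union_inter_distrib_right, Finset.inter_eq_left.2 hCB,
      Finset.disjoint_iff_inter_eq_empty.1 (hAB.mono_left heA), Finset.empty_union]
  have hFsub : e ∪ C ⊆ A ∪ B := Finset.union_subset_union heA hCB
  have hlink : ∀ z, K (insert z (e ∪ C)) ↔ z ∈ e ∪ C ∨ z = u ∨ z = v := by
    intro z
    rw [hK]
    by_cases hzF : z ∈ e ∪ C
    · rw [Finset.insert_eq_of_mem hzF, hFA, hFB]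
      exact iff_of_true ⟨hFsub, he, hCB.ssubset_of_ne fun h => huC (h ▸ hu)⟩ (Or.inl hzF)
    · by_cases hzA : z ∈ A
      · refine iff_of_false (fun h => ?_) ?_
        · have h1 := hdim _ h.2.1
          rw [Finset.insert_inter_of_mem hzA, hFA, Finset.card_insert_of_notMem
            fun h => hzF (Finset.mem_union_left _ h)] at h1
          omega
        · rintro (h | rfl | rfl)
          exacts [hzF h, hA' _ hzA hu, hA' _ hzA hv]
      · rw [Finset.insert_inter_of_notMem hzA, hFA]
        constructor
        · rintro ⟨h, -, -⟩
          have hzB : z ∈ B := (Finset.mem_union.1 (h (Finset.mem_insert_self _ _))).resolve_left hzA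
          by_contra hcon
          push Not at hcon
          exact hzF (Finset.mem_union_right _ (by simp [hC, hzB, hcon]))
        · intro h
          have hz : z = u ∨ z = v := h.resolve_left hzF
          have hzB : z ∈ B := by rcases hz with rfl | rfl <;> assumption
          refine ⟨Finset.insert_subset (Finset.mem_union_right _ hzB) hFsub, he, ?_⟩
          rw [Finset.insert_inter_of_mem hzB, hFB]
          refine (Finset.insert_subset hzB hCB).ssubset_of_ne fun h' => ?_
          have := Finset.card_insert_le z C
          rw [h'] at this
          omega
  refine ⟨e ∪ C, u, v, ?_, ?_, huv, by simp [huC, hue], by simp [hvC, hve], hlink⟩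
  · obtain ⟨x, hx⟩ : e.Nonempty := Finset.card_pos.1 (by omega)
    have := (hlink x).2 (Or.inl (by simp [hx]))
    rwa [Finset.insert_eq_of_mem (by simp [hx])] at this
  · rw [Finset.card_union_of_disjoint hdis]
    omega

end Join

/-! ### Free sums of configurations -/

section FreeSum

open scoped Classical

section Subspace

variable {E : Type*} [NormedAddCommGroup E] [InnerProductSpace ℝ E]
  {U : Submodule ℝ E}

/-- A finite subset of a subspace, as a finite subset of the ambient space. -/
def coeFinset (U : Submodule ℝ E) (A : Finset U) : Finset E :=
  A.map (Function.Embedding.subtype _)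

lemma mem_of_mem_coeFinset {A : Finset U} {x : E} (hx : x ∈ coeFinset U A) : x ∈ U := by
  obtain ⟨y, -, rfl⟩ := Finset.mem_map.1 hx
  exact y.2

lemma coe_coeFinset (A : Finset U) : (coeFinset U A : Set E) = U.subtype '' (A : Set U) := by
  simp [coeFinset]

lemma card_coeFinset (A : Finset U) : (coeFinset U A).card = A.card :=
  Finset.card_map _

lemma exists_coeFinset_eq {A : Finset U} {s : Finset E} (hs : s ⊆ coeFinset U A) :
    ∃ t ⊆ A, s = coeFinset U t :=
  Finset.subset_map_iff.1 hs

lemma convexHull_coeFinset (A : Finset U) : convexHull ℝ (coeFinset U A : Set E) =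
    U.subtype '' convexHull ℝ (A : Set U) := by
  rw [coe_coeFinset, LinearMap.image_convexHull]

lemma AffineIndependent.map_coe {A : Finset U} (hA : AffineIndependent ℝ ((↑) : A → U)) :
    AffineIndependent ℝ ((↑) : coeFinset U A → E) := by
  have h := (hA.map' U.subtype.toAffineMap U.subtype_injective).range
  have hr : Set.range (U.subtype.toAffineMap ∘ ((↑) : A → U)) = (coeFinset U A : Set E) := by
    rw [coe_coeFinset, Set.range_comp]
    simp
  rw [hr] at h
  exact h

lemma IsSpanningConfiguration.eq_zero_of_nonpos {A : Finset U} (hA : IsSpanningConfiguration A)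
    {l : E →L[ℝ] ℝ} (hl : ∀ v ∈ coeFinset U A, l v ≤ 0) {x : E} (hx : x ∈ U) : l x = 0 := by
  have := hA.pos (l.comp U.subtypeL) fun v hv => hl v (Finset.mem_map_of_mem _ hv)
  exact DFunLike.congr_fun this ⟨x, hx⟩

variable [FiniteDimensional ℝ E]

lemma exists_extension (U : Submodule ℝ E) (l : U →L[ℝ] ℝ) :
    ∃ m : E →L[ℝ] ℝ, (∀ x : U, m x = l x) ∧ ∀ x ∈ Uᗮ, m x = 0 :=
  ⟨l.comp U.orthogonalProjectionOnto, fun x => by simp, fun x hx => by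
    simp [Submodule.orthogonalProjectionOnto_eq_zero_iff.2 hx]⟩

lemma isPolarFace_coeFinset {A s : Finset U} :
    IsPolarFace (coeFinset U A) (coeFinset U s) ↔ IsPolarFace A s := by
  simp only [IsPolarFace, IsPolar, coeFinset, Finset.map_subset_map, Finset.forall_mem_map]
  refine and_congr_right fun _ => ⟨?_, ?_⟩
  · rintro ⟨l, h1, h2⟩
    exact ⟨l.comp U.subtypeL, h1, h2⟩
  · rintro ⟨l, h1, h2⟩
    obtain ⟨m, hm, -⟩ := exists_extension U l
    exact ⟨m, fun x hx => (hm x).trans_le (h1 x hx), fun x hx => (hm x).trans (h2 x hx)⟩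

lemma IsSimplicialConfiguration.map_coe {A : Finset U} (hA : IsSimplicialConfiguration A) :
    IsSimplicialConfiguration (coeFinset U A) := by
  refine ⟨fun s hs => ?_, fun v hv => ?_⟩
  · obtain ⟨t, -, rfl⟩ := exists_coeFinset_eq hs.1
    have h := hA.indep t (isPolarFace_coeFinset.1 hs)
    rw [coe_coeFinset]
    have h' : LinearIndepOn ℝ U.subtype (t : Set U) := by
      have := LinearIndependent.map' (show LinearIndependent ℝ ((↑) : ↥(t : Set U) → U) from h)
        U.subtype (by simp)
      exact this
    exact h'.id_image
  · obtain ⟨x, hx, rfl⟩ := Finset.mem_map.1 hv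
    have := isPolarFace_coeFinset.2 (hA.vertex x hx)
    rwa [show coeFinset U {x} = {(x : E)} from Finset.map_singleton _ _] at this

lemma card_edgesOf_coeFinset (A : Finset U) :
    (edgesOf (coeFinset U A) (IsPolarFace (coeFinset U A))).card =
      (edgesOf A (IsPolarFace A)).card := by
  have : edgesOf (coeFinset U A) (IsPolarFace (coeFinset U A)) =
      (edgesOf A (IsPolarFace A)).image (coeFinset U) := by
    ext e
    simp only [edgesOf, Finset.mem_filter, Finset.mem_powersetCard, Finset.mem_image]
    constructor
    · rintro ⟨⟨h1, h2⟩, h3⟩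
      obtain ⟨t, ht, rfl⟩ := exists_coeFinset_eq h1
      exact ⟨t, ⟨⟨ht, by rwa [card_coeFinset] at h2⟩, isPolarFace_coeFinset.1 h3⟩, rfl⟩
    · rintro ⟨t, ⟨⟨h1, h2⟩, h3⟩, rfl⟩
      have h3' := isPolarFace_coeFinset.2 h3
      exact ⟨⟨h3'.1, by rwa [card_coeFinset]⟩, h3'⟩
  rw [this]
  exact Finset.card_image_of_injective _ (Finset.map_injective _)

lemma IsSpanningConfiguration.isPolytopeOfDim_coeFinset [Nontrivial U] {A : Finset U}
    (hA : IsSpanningConfiguration A) {k : ℕ} (hU : Module.finrank ℝ U = k) :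
    IsPolytopeOfDim k (convexHull ℝ (coeFinset U A : Set E)) := by
  refine ⟨⟨_, hA.nonempty.map, rfl⟩, ?_⟩
  have h := AffineMap.map_vectorSpan (k := ℝ) (f := U.subtype.toAffineMap)
    (s := convexHull ℝ (A : Set U))
  rw [hA.vectorSpan_convexHull_eq_top] at h
  rw [convexHull_coeFinset, show U.subtype '' convexHull ℝ (A : Set U) =
    U.subtype.toAffineMap '' convexHull ℝ (A : Set U) from rfl, ← h]
  exact (Submodule.finrank_map_subtype_eq U ⊤).trans (finrank_top ℝ U |>.trans hU)

lemma IsSpanningConfiguration.zero_mem_intrinsicInterior_coeFinset [Nontrivial U] {A : Finset U}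
    (hA : IsSpanningConfiguration A) :
    (0 : E) ∈ intrinsicInterior ℝ (convexHull ℝ (coeFinset U A : Set E)) := by
  rw [convexHull_coeFinset, show U.subtype '' convexHull ℝ (A : Set U) =
    U.subtypeₗᵢ.toAffineIsometry '' convexHull ℝ (A : Set U) from rfl,
    AffineIsometry.intrinsicInterior_image]
  exact ⟨0, interior_subset_intrinsicInterior hA.zero_mem_interior, by simp⟩

end Subspace

variable {E : Type*} [NormedAddCommGroup E] [InnerProductSpace ℝ E]
  {U : Submodule ℝ E}

/-- Only `0` lies in both subspaces, and `0` is never a point of a configuration, as some functional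
is `1` at each point. -/
lemma IsSimplicialConfiguration.disjoint {A B : Finset E} (hA : ∀ a ∈ A, a ∈ U)
    (hB : ∀ b ∈ B, b ∈ Uᗮ) (hAc : IsSimplicialConfiguration A) : Disjoint A B := by
  rw [Finset.disjoint_left]
  intro x hxA hxB
  have hx : x = 0 := (Submodule.disjoint_def.1 U.orthogonal_disjoint) x (hA x hxA) (hB x hxB)
  obtain ⟨-, l, -, hl⟩ := hAc.vertex x hxA
  have := hl x (by simp)
  simp [hx] at this

variable [FiniteDimensional ℝ E]

/-- The faces of a free sum form a join: functionals on `U` and `Uᗮ`, each extended by zero to the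
other subspace, can be added without interfering. -/
lemma isPolarFace_union {A B : Finset E} (hA : ∀ a ∈ A, a ∈ U) (hB : ∀ b ∈ B, b ∈ Uᗮ)
    (s : Finset E) : IsPolarFace (A ∪ B) s ↔
      s ⊆ A ∪ B ∧ IsPolarFace A (s ∩ A) ∧ IsPolarFace B (s ∩ B) := by
  constructor
  · rintro ⟨hs, l, hl, hls⟩
    exact ⟨hs, ⟨Finset.inter_subset_right, l, fun v hv => hl v (Finset.mem_union_left _ hv),
      fun v hv => hls v (Finset.mem_inter.1 hv).1⟩, ⟨Finset.inter_subset_right, l,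
      fun v hv => hl v (Finset.mem_union_right _ hv), fun v hv => hls v (Finset.mem_inter.1 hv).1⟩⟩
  · rintro ⟨hs, ⟨-, l, hl, hls⟩, ⟨-, m, hm, hms⟩⟩
    obtain ⟨l', hl1, hl2⟩ := exists_extension U (l.comp U.subtypeL)
    obtain ⟨m', hm1, hm2⟩ := exists_extension Uᗮ (m.comp Uᗮ.subtypeL)
    have h1 : ∀ a ∈ A, (l' + m') a = l a := fun a ha => by
      have h1 := hl1 ⟨a, hA a ha⟩
      have h2 := hm2 a (U.le_orthogonal_orthogonal (hA a ha))
      simpa [h2] using h1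
    have h2 : ∀ b ∈ B, (l' + m') b = m b := fun b hb => by
      have h1 := hm1 ⟨b, hB b hb⟩
      have h2 := hl2 b (hB b hb)
      simpa [h2] using h1
    refine ⟨hs, l' + m', fun v hv => ?_, fun v hv => ?_⟩
    · rcases Finset.mem_union.1 hv with h | h
      · exact (h1 v h).trans_le (hl v h)
      · exact (h2 v h).trans_le (hm v h)
    · rcases Finset.mem_union.1 (hs hv) with h | h
      · exact (h1 v h).trans (hls v (Finset.mem_inter.2 ⟨hv, h⟩))
      · exact (h2 v h).trans (hms v (Finset.mem_inter.2 ⟨hv, h⟩))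

lemma IsSimplicialConfiguration.union {A B : Finset E} (hA : ∀ a ∈ A, a ∈ U)
    (hB : ∀ b ∈ B, b ∈ Uᗮ) (hAc : IsSimplicialConfiguration A)
    (hBc : IsSimplicialConfiguration B) : IsSimplicialConfiguration (A ∪ B) := by
  refine ⟨fun s hs => ?_, fun v hv => ?_⟩
  · obtain ⟨h1, h2, h3⟩ := (isPolarFace_union hA hB s).1 hs
    have hs' : (s : Set E) = ((s ∩ A : Finset E) : Set E) ∪ ((s ∩ B : Finset E) : Set E) := by
      rw [← Finset.coe_union, ← Finset.inter_union_distrib_left, Finset.inter_eq_left.2 h1]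
    rw [hs']
    refine (hAc.indep _ h2).id_union (hBc.indep _ h3) (U.orthogonal_disjoint.mono ?_ ?_)
    · rw [Submodule.span_le]
      exact fun x hx => hA x (Finset.mem_inter.1 hx).2
    · rw [Submodule.span_le]
      exact fun x hx => hB x (Finset.mem_inter.1 hx).2
  · have hdis := hAc.disjoint hA hB
    rw [isPolarFace_union hA hB]
    refine ⟨Finset.singleton_subset_iff.2 hv, ?_⟩
    rcases Finset.mem_union.1 hv with h | h
    · rw [Finset.singleton_inter_of_mem h,
        Finset.singleton_inter_of_notMem (Finset.disjoint_left.1 hdis h)]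
      exact ⟨hAc.vertex v h, isPolarFace_empty B⟩
    · rw [Finset.singleton_inter_of_mem h,
        Finset.singleton_inter_of_notMem (Finset.disjoint_right.1 hdis h)]
      exact ⟨isPolarFace_empty A, hBc.vertex v h⟩

end FreeSum

/-! ### Prime polytopes from prime complexes -/

section Prime

open scoped Classical

variable {E : Type*} [NormedAddCommGroup E] [NormedSpace ℝ E] [FiniteDimensional ℝ E]
  [Nontrivial E] {V : Finset E} {d : ℕ}

namespace IsSpanningConfiguration

lemma f_zero (hV : IsSpanningConfiguration V) :
    (boundaryComplex (convexHull ℝ (V : Set E))).f 0 = V.card := by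
  have : {s ∈ (boundaryComplex (convexHull ℝ (V : Set E))).faces | s.card = 0 + 1} =
      ((V.image fun v => {v} : Finset (Finset E)) : Set (Finset E)) := by
    ext s
    simp only [Set.mem_ofPred_eq, hV.mem_faces_boundaryComplex, Finset.coe_image, Set.mem_image,
      Finset.mem_coe, zero_add]
    constructor
    · rintro ⟨⟨-, hs⟩, hc⟩
      obtain ⟨v, rfl⟩ := Finset.card_eq_one.1 hc
      exact ⟨v, hs.1 (by simp), rfl⟩
    · rintro ⟨v, hv, rfl⟩
      exact ⟨⟨by simp, hV.vertex v hv⟩, by simp⟩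
  rw [PreAbstractSimplicialComplex.f, this, Set.ncard_coe_finset,
    Finset.card_image_of_injective _ Finset.singleton_injective]

lemma f_one (hV : IsSpanningConfiguration V) :
    (boundaryComplex (convexHull ℝ (V : Set E))).f 1 = (edgesOf V (IsPolarFace V)).card := by
  have : {s ∈ (boundaryComplex (convexHull ℝ (V : Set E))).faces | s.card = 1 + 1} =
      (edgesOf V (IsPolarFace V) : Set (Finset E)) := by
    ext s
    simp only [Set.mem_ofPred_eq, hV.mem_faces_boundaryComplex, edgesOf, Finset.coe_filter,
      Finset.mem_powersetCard]
    constructor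
    · rintro ⟨⟨-, hs⟩, hc⟩
      exact ⟨⟨hs.1, hc⟩, hs⟩
    · rintro ⟨⟨-, hc⟩, hs⟩
      exact ⟨⟨Finset.card_pos.1 (by omega), hs⟩, hc⟩
  rw [PreAbstractSimplicialComplex.f, this, Set.ncard_coe_finset]

lemma maxFaceSize_eq (hV : IsSpanningConfiguration V) (hd : 1 ≤ d)
    (hdim : ∀ s, IsPolarFace V s → s.card ≤ d) {s : Finset E} (hs : IsPolarFace V s)
    (hsd : s.card = d) :
    (boundaryComplex (convexHull ℝ (V : Set E))).maxFaceSize = d := by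
  apply IsGreatest.csSup_eq
  constructor
  · exact ⟨s, hV.mem_faces_boundaryComplex.2 ⟨Finset.card_pos.1 (by omega), hs⟩, hsd⟩
  · rintro _ ⟨t, ht, rfl⟩
    exact hdim t (hV.mem_faces_boundaryComplex.1 ht).2

lemma isPrimePolytope (hV : IsSpanningConfiguration V) (hE : Module.finrank ℝ E = d)
    (hd : 2 ≤ d) (hK : IsPrimeComplex d V (IsPolarFace V)) :
    IsPrimePolytope d (convexHull ℝ (V : Set E)) := by
  refine ⟨hV.isSimplicialPolytope hE, ?_, ?_⟩
  · rintro F ⟨hne, hsub, hF, hall⟩ hcard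
    apply hF
    rw [hV.mem_faces_boundaryComplex]
    refine ⟨hne, hK.noMissing F (fun x hx => ?_) (fun x hx => ?_) hcard⟩
    · have h1 : (F.erase x).Nonempty := by
        rw [← Finset.card_pos, Finset.card_erase_of_mem hx]
        omega
      exact (hV.mem_faces_boundaryComplex.1 (hall _ h1 (Finset.erase_ssubset hx))).2
    · exact (hV.mem_faces_boundaryComplex.1 (hsub hx)).2.1 (by simp)
  · rintro ⟨W, hW⟩
    obtain ⟨G, hGV, hG⟩ := hK.notSimplex
    -- If the complex were the boundary of a simplex on `W`, the proper subset `G` of `V ⊆ W` would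
    -- be a face.
    have hVW : V ⊆ W := fun v hv =>
      ((hW {v}).1 (hV.mem_faces_boundaryComplex.2 ⟨by simp, hV.vertex v hv⟩)).2.1 (by simp)
    have hGne : G.Nonempty := by
      by_contra h
      rw [Finset.not_nonempty_iff_eq_empty] at h
      exact hG (h ▸ isPolarFace_empty V)
    exact hG (hV.mem_faces_boundaryComplex.1 ((hW G).2 ⟨hGne, hGV.trans_subset hVW⟩)).2

end IsSpanningConfiguration

/-- The invariants of the configurations that occur in the iterated ridge subdivision. -/
structure IsRidgeState (d : ℕ) (V : Finset E) : Prop where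
  spanning : IsSpanningConfiguration V
  prime : IsPrimeComplex d V (IsPolarFace V)
  ridge : ∃ F u v, IsRidge d (IsPolarFace V) F u v

lemma IsRidgeState.g2_eq (hV : IsRidgeState d V) (hd : 1 ≤ d) :
    (boundaryComplex (convexHull ℝ (V : Set E))).g2 =
      (edgesOf V (IsPolarFace V)).card - d * V.card + ((d + 1).choose 2 : ℤ) := by
  obtain ⟨F, u, v, hR⟩ := hV.ridge
  rw [PreAbstractSimplicialComplex.g2, hV.spanning.f_zero, hV.spanning.f_one,
    -- The ridge together with `u` is a face with exactly `d` vertices.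
    hV.spanning.maxFaceSize_eq hd hV.prime.dim ((hR.link u).2 (by simp))
      (by rw [Finset.card_insert_of_notMem hR.left, hR.card])]

lemma IsRidgeState.exists_subdivision (hV : IsRidgeState d V) (hE : Module.finrank ℝ E = d)
    (hd : 4 ≤ d) : ∃ V' : Finset E, IsRidgeState d V' ∧ V.card ≤ V'.card ∧
      (boundaryComplex (convexHull ℝ (V' : Set E))).g2 =
        (boundaryComplex (convexHull ℝ (V : Set E))).g2 + 1 ∧
      IsRidgeSubdivision d (convexHull ℝ (V : Set E)) (convexHull ℝ (V' : Set E)) := by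
  obtain ⟨F, u, v, hR⟩ := hV.ridge
  have hc := hR.card
  have hne : F.Nonempty := Finset.card_pos.1 (by omega)
  obtain ⟨w, hw, hV', hface⟩ := hV.spanning.exists_stellar hR.face (by omega)
  have hfun : IsPolarFace (insert w V) = IsStellarFace (IsPolarFace V) F w :=
    funext fun s => propext (hface s)
  have hstate : IsRidgeState d (insert w V) :=
    ⟨hV', hfun ▸ hR.isPrimeComplex hd hV.prime hw, by
      obtain ⟨F', hF'⟩ := hR.stellar hd hV.prime hw
      exact ⟨F', u, v, hfun ▸ hF'⟩⟩
  refine ⟨insert w V, hstate, Finset.card_le_card (Finset.subset_insert _ _), ?_,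
    hV.spanning.isSimplicialPolytope hE, hV'.isSimplicialPolytope hE, F,
    hV.spanning.mem_faces_boundaryComplex.2 ⟨hne, hR.face⟩, hc,
    hV.spanning.stellarSubdivision_isIsomorphicTo hR.face hw hV' hface hne⟩
  rw [hstate.g2_eq (by omega), hV.g2_eq (by omega), hfun, hR.card_edgesOf hd hV.prime hw,
    Finset.card_insert_of_notMem hw]
  push_cast
  ring

end Prime

/-! ### The initial free sum and the iteration of ridge subdivisions -/

section Main

open scoped Classical

lemma exists_polygonSimplexSum {E : Type*} [NormedAddCommGroup E] [InnerProductSpace ℝ E]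
    [FiniteDimensional ℝ E] [Nontrivial E] {d n : ℕ} (hE : Module.finrank ℝ E = d) (hd : 4 ≤ d)
    (hn : 3 ≤ n) : ∃ V : Finset E, IsRidgeState d V ∧ n ≤ V.card ∧
      (boundaryComplex (convexHull ℝ (V : Set E))).g2 = 1 ∧
      IsPolygonSimplexSum d n (convexHull ℝ (V : Set E)) := by
  obtain ⟨f, hf⟩ := exists_linearIndependent_of_le_finrank (R := ℝ) (M := E) (n := 2) (by omega)
  set U := Submodule.span ℝ (Set.range f) with hU
  have hU2 : Module.finrank ℝ U = 2 := by simpa using finrank_span_eq_card hf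
  have hU' : Module.finrank ℝ Uᗮ = d - 2 := by
    have := U.finrank_add_finrank_orthogonal
    omega
  have : Nontrivial U := Module.nontrivial_of_finrank_pos (R := ℝ) (by omega)
  have : Nontrivial Uᗮ := Module.nontrivial_of_finrank_pos (R := ℝ) (by omega)
  obtain ⟨A₀, hA₀, hAcard, hAdim, hAedges⟩ := exists_spanning_polygon hU2 n hn
  obtain ⟨B₀, hB₀, hBcard, hBface, hBaff⟩ := exists_spanning_simplex (by omega) hU'
  set A := coeFinset U A₀ with hAdef
  set B := coeFinset Uᗮ B₀ with hBdef
  have hA : ∀ a ∈ A, a ∈ U := fun a ha => mem_of_mem_coeFinset ha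
  have hB : ∀ b ∈ B, b ∈ Uᗮ := fun b hb => mem_of_mem_coeFinset hb
  have hAc : IsSimplicialConfiguration A := hA₀.toIsSimplicialConfiguration.map_coe
  have hBc : IsSimplicialConfiguration B := hB₀.toIsSimplicialConfiguration.map_coe
  have hAB : Disjoint A B := hAc.disjoint hA hB
  have hAn : A.card = n := (card_coeFinset A₀).trans hAcard
  have hBn : B.card + 1 = d := by rw [hBdef, card_coeFinset, hBcard]; omega
  have hAdim' : ∀ s, IsPolarFace A s → s.card ≤ 2 := fun s hs => by
    obtain ⟨t, -, rfl⟩ := exists_coeFinset_eq hs.1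
    rw [card_coeFinset]
    exact hAdim t (isPolarFace_coeFinset.1 hs)
  have hBface' : ∀ s, IsPolarFace B s ↔ s ⊂ B := fun s => by
    constructor
    · intro hs
      obtain ⟨t, -, rfl⟩ := exists_coeFinset_eq hs.1
      exact Finset.map_ssubset_map.2 ((hBface t).1 (isPolarFace_coeFinset.1 hs))
    · intro hs
      obtain ⟨t, -, rfl⟩ := exists_coeFinset_eq hs.1
      exact isPolarFace_coeFinset.2 ((hBface t).2 (Finset.map_ssubset_map.1 hs))
  have hK : ∀ s, IsPolarFace (A ∪ B) s ↔ s ⊆ A ∪ B ∧ IsPolarFace A (s ∩ A) ∧ s ∩ B ⊂ B := by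
    intro s
    rw [isPolarFace_union hA hB, hBface']
  have hspan : IsSpanningConfiguration (A ∪ B) := by
    refine ⟨hAc.union hA hB hBc, fun l hl => ?_⟩
    ext x
    -- A functional nonpositive on `A ∪ B` vanishes on `U` and on `Uᗮ`, hence everywhere.
    rw [← U.starProjection_add_starProjection_orthogonal x, map_add,
      hA₀.eq_zero_of_nonpos (fun v hv => hl v (Finset.mem_union_left _ hv))
        (U.starProjection_apply_mem x),
      hB₀.eq_zero_of_nonpos (fun v hv => hl v (Finset.mem_union_right _ hv))
        (Uᗮ.starProjection_apply_mem x)]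
    simp
  have hAedges' : (edgesOf A (IsPolarFace A)).card = n := by
    rw [hAdef, card_edgesOf_coeFinset, hAedges]
  obtain ⟨e, he⟩ : (edgesOf A (IsPolarFace A)).Nonempty := Finset.card_pos.1 (by omega)
  have hstate : IsRidgeState d (A ∪ B) :=
    ⟨hspan, isPrimeComplex_join hd hAB (isPolarFace_empty A) (fun s t hs hts => hs.mono hts)
      hAc.vertex hAdim' (Finset.card_pos.1 (by omega)) hBn hK,
      exists_isRidge_join hd hAB (fun s hs => hs.1) hAdim' hBn hK (Finset.mem_filter.1 he).2
        (Finset.mem_powersetCard.1 (Finset.mem_filter.1 he).1).2⟩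
  refine ⟨A ∪ B, hstate, ?_, ?_, convexHull ℝ (A : Set E), convexHull ℝ (B : Set E),
    hA₀.isPolytopeOfDim_coeFinset hU2, ?_, hB₀.isPolytopeOfDim_coeFinset hU',
    ⟨B, hBaff.map_coe, rfl⟩, ?_, hA₀.zero_mem_intrinsicInterior_coeFinset,
    hB₀.zero_mem_intrinsicInterior_coeFinset, ?_⟩
  · rw [Finset.card_union_of_disjoint hAB]
    omega
  · rw [hstate.g2_eq (by omega), card_edgesOf_join hAB (fun s hs => hs.1) (isPolarFace_empty A)
      hAc.vertex (by omega) hK, Finset.card_union_of_disjoint hAB, hAedges', hAn, ← hBn]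
    have h1 : ((B.card + 1 + 1).choose 2 : ℤ) = B.card + 1 + (B.card + B.card.choose 2) := by
      rw [Nat.choose_succ_succ' (B.card + 1) 1, Nat.choose_succ_succ' B.card 1]
      simp
    have h2 : 2 * (B.card.choose 2 : ℤ) = B.card * (B.card - 1) := by
      have : 2 * (B.card.choose 2 : ℚ) = B.card * (B.card - 1) := by
        rw [Nat.cast_choose_two]
        ring
      exact_mod_cast this
    push_cast
    rw [h1]
    -- With `m = B.card = d - 1`, all terms in `n` cancel and the claim reduces to `2 (m choose 2) =
    -- m (m - 1)`.
    linear_combination h2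
  · rw [hAc.extremePoints_convexHull, Set.ncard_coe_finset, hAn]
  · have hle : ∀ (W : Submodule ℝ E) (X : Finset E), (∀ x ∈ X, x ∈ W) →
        convexHull ℝ (X : Set E) ⊆ W := fun W X h => convexHull_min h W.convex
    exact fun x hx y hy => Submodule.inner_right_of_mem_orthogonal (hle U A hA hx) (hle _ B hB hy)
  · rw [convexHull_convexHull_union_left, convexHull_convexHull_union_right, Finset.coe_union]

end Main

theorem mainTheorem5 (d b : ℕ) (hd : 4 ≤ d) (hb : 1 ≤ b) (N : ℕ) :
    ∃ P : Set (EuclideanSpace ℝ (Fin d)),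
      IsPrimePolytope d P ∧
      (boundaryComplex P).g2 = (b : ℤ) ∧
      N ≤ (boundaryComplex P).f 0 ∧
      ∃ n : ℕ, 3 ≤ n ∧ ∃ Q : ℕ → Set (EuclideanSpace ℝ (Fin d)),
        IsPolygonSimplexSum d n (Q 0) ∧
        (∀ i : ℕ, i + 1 < b → IsRidgeSubdivision d (Q i) (Q (i + 1))) ∧
        Q (b - 1) = P := by
  have hE : Module.finrank ℝ (EuclideanSpace ℝ (Fin d)) = d := by simp
  have : Nontrivial (EuclideanSpace ℝ (Fin d)) :=
    Module.nontrivial_of_finrank_pos (R := ℝ) (by omega)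
  -- The polygon gets `N + 3` vertices: at least three, and enough for the bound `N`, since later
  -- steps only add vertices.
  obtain ⟨V, hV, hcard, hg, hsum⟩ := exists_polygonSimplexSum hE hd (Nat.le_add_left 3 N)
  choose next hnext hle hg2 hsub using
    fun x : {V : Finset (EuclideanSpace ℝ (Fin d)) // IsRidgeState d V} =>
      x.2.exists_subdivision hE hd
  let q : ℕ → {V : Finset (EuclideanSpace ℝ (Fin d)) // IsRidgeState d V} :=
    -- After `i` subdivisions `g₂` is `i + 1`, so the polytope sought is the one with index `b - 1`.
    fun i => (fun x => ⟨next x, hnext x⟩)^[i] ⟨V, hV⟩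
  have hq : ∀ i, (q (i + 1) : Finset (EuclideanSpace ℝ (Fin d))) = next (q i) := fun i => by
    simp only [q, Function.iterate_succ_apply']
  have hqcard : ∀ i, N ≤ (q i : Finset (EuclideanSpace ℝ (Fin d))).card := fun i => by
    induction i with
    | zero => exact (Nat.le_add_right N 3).trans hcard
    | succ i ih =>
      rw [hq]
      exact ih.trans (hle _)
  have hqg : ∀ i, (boundaryComplex (convexHull ℝ
      ((q i : Finset (EuclideanSpace ℝ (Fin d))) : Set (EuclideanSpace ℝ (Fin d))))).g2 = i + 1 :=
    fun i => by
      induction i with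
      | zero => simpa [q] using hg
      | succ i ih => rw [hq, hg2, ih, Nat.cast_add_one]
  refine ⟨_, (q (b - 1)).2.spanning.isPrimePolytope hE (by omega) (q (b - 1)).2.prime, ?_, ?_,
    N + 3, by omega, fun i => convexHull ℝ (q i : Finset (EuclideanSpace ℝ (Fin d))), hsum,
    fun i _ => ?_, rfl⟩
  · rw [hqg]
    omega
  · rw [(q (b - 1)).2.spanning.f_zero]
    exact hqcard _
  · simp only [hq]
    exact hsub _
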